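/- **Model.** Let the state space be $\mathbb R$, the action space $A$ a Borel space, $(\mathcal Z,\mathfrak Z)$ a measurable space of disturbances and $N\in\mathbb N$ the horizon. For $n=0,\dots,N-1$ let $D_n\subseteq\mathbb R\times A$ be measurable and contain the graph of a measurable map $\mathbb R\to A$; put $D_n(x)=\{a:(x,a)\in D_n\}$. Let $T_n:D_n\times\mathcal Z\to\mathbb R$, $c_n:D_n\times\mathbb R\to\mathbb R$ and $c_N:\mathbb R\to\mathbb R$ be measurable. Let $\mathbb P_1,\dots,\mathbb P_N$ be separable probability measures on $\mathcal Z$ (the laws of the disturbances), let $q\in(1,\infty]$, $\frac1p+\frac1q=1$, and let $\mathcal Q_n$ be a non-empty set of probability measures $\mathbb Q\ll\mathbb P_n$ with $d\mathbb Q/d\mathbb P_n\in L^q(\mathbb P_n)$. Via densities, $\mathcal Q_n$ is a subset of $L^q(\mathbb P_n)$ and carries the weak* topology $\sigma(L^q,L^p)$ and its Borel $\sigma$-algebra. **Policies and values.** Let $\mathcal H_n$ be the set of histories $h_n=(x_0,a_0,\dots,x_n)$ with $a_k\in D_k(x_k)$. $\Pi^R$ is the set of randomized policies $\pi=(\pi_0,\dots,\pi_{N-1})$,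 $\pi_n$ a stochastic kernel from $\mathcal H_n$ to $A$ with $\pi_n(D_n(x_n)|h_n)=1$; $\Pi^M$ the set of deterministic Markov policies $(d_0,\dots,d_{N-1})$, $d_n:\mathbb R\to A$ measurable with $d_n(x)\in D_n(x)$; $\Gamma$ the set of policies of nature, i.e. sequences of measurable maps $\gamma_n:(h_n,a_n)\mapsto\gamma_n(h_n,a_n)\in\mathcal Q_{n+1}$; $\Gamma^M$ the set of sequences of measurable maps $\gamma_n:D_n\to\mathcal Q_{n+1}$. Given $h_n$, an action $a_n$ is drawn from $\pi_n(\cdot|h_n)$, $z_{n+1}$ from $\gamma_n(h_n,a_n)$, and $x_{n+1}=T_n(x_n,a_n,z_{n+1})$. With the resulting conditional law given $H_n=h_n$ put $$V_{n\pi\gamma}(h_n)=\mathbb E^{\pi\gamma}_{nh_n}\Big[\sum_{k=n}^{N-1}c_k(X_k,A_k,X_{k+1})+c_N(X_N)\Big],\quad V_{n\pi}=\sup_{\gamma\in\Gamma}V_{n\pi\gamma},\quad V_n=\inf_{\pi\in\Pi^R}V_{n\pi}.$$ For $\pi\in\Pi^M$, $\gamma\in\Gamma^M$ write $J_{n\pi\gamma}(x)$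 for the value started at time $n$ in state $x$, $J_{n\pi}=\sup_{\gamma\in\Gamma^M}J_{n\pi\gamma}$, $J_n=\inf_{\pi\in\Pi^M}J_{n\pi}$. Put $L_nv(x,a,\mathbb Q)=\int c_n(x,a,T_n(x,a,z))+v(T_n(x,a,z))\,\mathbb Q(dz)$ and $$\mathcal T_{nd\gamma}v(x)=L_nv(x,d(x),\gamma(x,d(x))),\quad \mathcal T_{nd}v(x)=\sup_{\mathbb Q\in\mathcal Q_{n+1}}L_nv(x,d(x),\mathbb Q),\quad \mathcal T_nv(x)=\inf_{a\in D_n(x)}\sup_{\mathbb Q\in\mathcal Q_{n+1}}L_nv(x,a,\mathbb Q).$$ **Assumptions** (for all $n=0,\dots,N-1$; "increasing" in the weak sense). 1. There are $\alpha,\underline\epsilon,\bar\epsilon\ge0$ with $\underline\epsilon+\bar\epsilon=1$, $\alpha\ne1$, and measurable $\underline b:\mathbb R\to(-\infty,-\underline\epsilon]$, $\bar b:\mathbb R\to[\bar\epsilon,\infty)$ such that $\underline b\le c_N\le\bar b$ and, for all $\mathbb Q\in\mathcal Q_{n+1}$, $(x,a)\in D_n$, writing $T=T_n(x,a,\cdot)$: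 $\mathbb E^{\mathbb Q}[-c_n^-(x,a,T)]\ge\underline b(x)$, $\mathbb E^{\mathbb Q}[\underline b(T)]\ge\alpha\underline b(x)$, $\mathbb E^{\mathbb Q}[c_n^+(x,a,T)]\le\bar b(x)$, $\mathbb E^{\mathbb Q}[\bar b(T)]\le\alpha\bar b(x)$. 2. With $b=\bar b-\underline b$: every $(\bar x,\bar a)\in D_n$ has a neighbourhood $U$ and measurable $\Theta_1,\Theta_2:\mathcal Z\to\mathbb R_+$ in $L^p(\mathbb P_{n+1})$ with $|c_n(x,a,T_n(x,a,z))|\le\Theta_1(z)$ and $b(T_n(x,a,z))\le\Theta_2(z)$ for all $z$ and all $(x,a)\in U\cap D_n$. 3. The densities $d\mathbb Q/d\mathbb P_n$, $\mathbb Q\in\mathcal Q_n$, $n=1,\dots,N$, are bounded in $L^q$-norm by one constant $K\in[1,\infty)$. 4. The sets $D_n(x)$ are compact and $x\mapsto D_n(x)$ is upper semicontinuous: if $x_k\to x$ and $a_k\in D_n(x_k)$, then $(a_k)$ has an accumulation point in $D_n(x)$. For each $z$, $(x,a)\mapsto T_n(x,a,z)$ is lower semicontinuous on $D_n$; $c_n$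 and $c_N$ are lower semicontinuous. 5. $x\mapsto D_n(x)$ is decreasing; $x\mapsto T_n(x,a,z)$ and $(x,x')\mapsto c_n(x,a,x')$ are increasing (where $a\in D_n(x)$); $c_N$ is increasing. Let $\mathbb B$ be the set of measurable, lower semicontinuous, increasing $v:\mathbb R\to\mathbb R$ with $|v|\le\lambda b$ for some $\lambda\ge0$. **Proposition.** All the quantities above are well defined: the total costs are integrable and there is a constant $C$ with $|V_{n\pi\gamma}(h_n)|\le C\,b(x_n)$ for all $n,\pi,\gamma,h_n$; for $v\in\mathbb B$ and $n<N$ the integrals $L_nv(x,a,\mathbb Q)$ exist and are bounded by a constant (depending on $n,v$) times $b(x)$; and $V_{n\pi\gamma}(h_n)=J_{n\pi\gamma}(x_n)$ for Markov policies. a) For $n=0,\dots,N$: $V_n(h_n)=J_n(x_n)$ for all $h_n\in\mathcal H_n$, and $J_n\in\mathbb B$; in particular $J_n$ is increasing. Moreover $\mathcal T_n\mathbb B\subseteq\mathbb B$ for $n<N$. The Bellman equation $J_N=c_N$, $J_n=\mathcal T_nJ_{n+1}$ ($n<N$) holds. There exist Markov decision rules $d_n^*$ with $\mathcal T_{nd_n^*}J_{n+1}=\mathcal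 T_nJ_{n+1}$, $n<N$, and every sequence $\pi^*=(d_0^*,\dots,d_{N-1}^*)$ of such minimizers is optimal: $J_{n\pi^*}=J_n$ and $V_{n\pi^*}=V_n$ on $\mathcal H_n$ for all $n\le N$. b) If $\mathcal Q_1,\dots,\mathcal Q_N$ are weak* closed, then for every such $\pi^*$ there is $\gamma^*\in\Gamma^M$ such that $\gamma_n^*(x,a)$ maximizes $L_nJ_{n+1}(x,a,\cdot)$ over $\mathcal Q_{n+1}$ for all $(x,a)\in D_n$ and $J_n=\mathcal T_{nd_n^*\gamma_n^*}J_{n+1}$ for all $n<N$; and every $\gamma^*\in\Gamma^M$ with $J_n=\mathcal T_{nd_n^*\gamma_n^*}J_{n+1}$ for all $n<N$ satisfies $J_n=J_{n\pi^*\gamma^*}$ for all $n\le N$. -/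

import Mathlib

open MeasureTheory ProbabilityTheory Filter Topology
open scoped ENNReal

noncomputable section

/-- The weak* topology `σ(L^q, L^p)` on `L^q(μ)`: the coarsest topology for which
`g ↦ ∫ f g dμ` is continuous for every `f ∈ L^p(μ)`. -/
@[reducible]
def weakStarLq {Z : Type*} [MeasurableSpace Z] (p q : ℝ≥0∞) (μ : Measure Z) :
    TopologicalSpace (Lp ℝ q μ) :=
  TopologicalSpace.induced (fun (g : Lp ℝ q μ) (f : Lp ℝ p μ) => ∫ z, f z * g z ∂μ) inferInstance

/-- Histories `(x₀, a₀, x₁, …, xₙ)` up to time `n`, the states in the first component and the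
actions in the second one. -/
abbrev Hist (A : Type*) (n : ℕ) : Type _ := (Fin (n + 1) → ℝ) × (Fin n → A)

/-- The current state `xₙ` of a history. -/
def Hist.last {A : Type*} {n : ℕ} (h : Hist A n) : ℝ := h.1 (Fin.last n)

/-- The history `(hₙ, aₙ, xₙ₊₁)`. -/
def Hist.snoc {A : Type*} {n : ℕ} (h : Hist A n) (a : A) (x : ℝ) : Hist A (n + 1) :=
  (Fin.snoc (α := fun _ => ℝ) h.1 x, Fin.snoc (α := fun _ => A) h.2 a)

theorem Hist.measurable_last {A : Type*} [MeasurableSpace A] {n : ℕ} :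
    Measurable (Hist.last : Hist A n → ℝ) :=
  (measurable_pi_apply _).comp measurable_fst

/-- Data of a distributionally robust Markov decision process with state space `ℝ`, action space
`A`, disturbance space `Z` and planning horizon `N`.

Only the stages `n < N` (for `P` and `𝒬`: the indices `1, …, N`) are ever relevant, and `T n`,
`c n` matter only at admissible pairs `(x, a) ∈ D n`; the values elsewhere are an arbitrary
measurable extension (which exists because `D n` is measurable). -/
structure RobustMDP (A : Type*) (Z : Type*) [MeasurableSpace A] [MeasurableSpace Z] where
  /-- planning horizon -/
  N : ℕ
  /-- admissible state-action pairs -/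
  D : ℕ → Set (ℝ × A)
  measurableSet_D : ∀ n, MeasurableSet (D n)
  /-- `D n` contains the graph of a measurable map; in particular its sections are nonempty -/
  exists_graph : ∀ n, ∃ d : ℝ → A, Measurable d ∧ ∀ x, (x, d x) ∈ D n
  /-- transition functions `Tₙ(x, a, z)` -/
  T : ℕ → ℝ → A → Z → ℝ
  measurable_T : ∀ n, Measurable fun w : (ℝ × A) × Z => T n w.1.1 w.1.2 w.2
  /-- one-stage costs `cₙ(x, a, x')` -/
  c : ℕ → ℝ → A → ℝ → ℝ
  measurable_c : ∀ n, Measurable fun w : (ℝ × A) × ℝ => c n w.1.1 w.1.2 w.2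
  /-- terminal cost -/
  cN : ℝ → ℝ
  measurable_cN : Measurable cN
  /-- `P n` is the reference law of the disturbance `Zₙ`, `n = 1, …, N` -/
  P : ℕ → Measure Z
  isProbabilityMeasure_P : ∀ n, IsProbabilityMeasure (P n)
  isSeparable_P : ∀ n, IsSeparable (P n)
  /-- conjugate exponents, `1/p + 1/q = 1` and `q ∈ (1, ∞]` -/
  p : ℝ≥0∞
  q : ℝ≥0∞
  holderConjugate : p.HolderConjugate q
  one_lt_q : 1 < q
  /-- ambiguity sets: probability measures with a `P n`-density in `L^q` -/
  𝒬 : ℕ → Set (Measure Z)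
  nonempty_𝒬 : ∀ n, (𝒬 n).Nonempty
  isProbabilityMeasure_𝒬 : ∀ n, ∀ Q ∈ 𝒬 n, IsProbabilityMeasure Q
  absolutelyContinuous_𝒬 : ∀ n, ∀ Q ∈ 𝒬 n, Q ≪ P n
  memLp_𝒬 : ∀ n, ∀ Q ∈ 𝒬 n, MemLp (fun z => (Q.rnDeriv (P n) z).toReal) q (P n)

namespace RobustMDP

variable {A : Type*} {Z : Type*} [MeasurableSpace A] [MeasurableSpace Z] (M : RobustMDP A Z)

instance (n : ℕ) : IsProbabilityMeasure (M.P n) := M.isProbabilityMeasure_P n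

/-! ### Ambiguity sets as measurable spaces -/

/-- The ambiguity set `𝒬ₙ` as a type. It is a type of its own so that it can carry the weak*
topology and its Borel `σ`-algebra. -/
def Amb (n : ℕ) : Type _ := {Q : Measure Z // Q ∈ M.𝒬 n}

variable {M} in
/-- The probability measure belonging to an element of the ambiguity set. -/
def Amb.measure {n : ℕ} (Q : M.Amb n) : Measure Z := Q.1

instance {n : ℕ} (Q : M.Amb n) : IsProbabilityMeasure Q.measure :=
  M.isProbabilityMeasure_𝒬 n Q.1 Q.2

variable {M} in
/-- The density `dQ/dPₙ` as an element of `L^q(Pₙ)`. -/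
def Amb.density {n : ℕ} (Q : M.Amb n) : Lp ℝ M.q (M.P n) := (M.memLp_𝒬 n Q.1 Q.2).toLp _

/-- `𝒬ₙ` carries the trace of the weak* topology `σ(L^q, L^p)`. -/
instance (n : ℕ) : TopologicalSpace (M.Amb n) :=
  TopologicalSpace.induced Amb.density (weakStarLq M.p M.q (M.P n))

instance (n : ℕ) : MeasurableSpace (M.Amb n) := borel _

instance (n : ℕ) : BorelSpace (M.Amb n) := ⟨rfl⟩

/-- The ambiguity sets `𝒬₁, …, 𝒬_N` are weak* closed. -/
def WeakStarClosed : Prop :=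
  ∀ n, 1 ≤ n → n ≤ M.N →
    IsClosed[weakStarLq M.p M.q (M.P n)] (Set.range (Amb.density : M.Amb n → Lp ℝ M.q (M.P n)))

theorem Amb.measurable_measure (n : ℕ) : Measurable (Amb.measure : M.Amb n → Measure Z) := by
  refine Measure.measurable_of_measurable_coe _ fun B hB => ?_
  have key : ∀ Q : M.Amb n, Q.measure B = ENNReal.ofReal
      (∫ z, (indicatorConstLp M.p hB (measure_ne_top (M.P n) B) (1 : ℝ)) z * Q.density z
        ∂(M.P n)) := by
    intro Q
    have h1 : ∫ z, (indicatorConstLp M.p hB (measure_ne_top (M.P n) B) (1 : ℝ)) z * Q.density z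
        ∂(M.P n) = ∫ z in B, (Q.measure.rnDeriv (M.P n) z).toReal ∂(M.P n) := by
      rw [← integral_indicator hB]
      refine integral_congr_ae ?_
      filter_upwards [indicatorConstLp_coeFn (p := M.p) (hs := hB)
        (hμs := measure_ne_top (M.P n) B) (c := (1 : ℝ)),
        (M.memLp_𝒬 n Q.1 Q.2).coeFn_toLp] with z hz1 hz2
      have hz2' : Q.density z = (Q.measure.rnDeriv (M.P n) z).toReal := hz2
      rw [hz1, hz2']
      by_cases hz : z ∈ B <;> simp [hz]
    have := M.isProbabilityMeasure_𝒬 n Q.1 Q.2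
    rw [h1, Amb.measure, Measure.setIntegral_toReal_rnDeriv (M.absolutelyContinuous_𝒬 n Q.1 Q.2)]
    exact (ofReal_measureReal).symm
  simp_rw [key]
  refine ENNReal.measurable_ofReal.comp (Continuous.measurable ?_)
  have hc : @Continuous _ _ (weakStarLq M.p M.q (M.P n)) inferInstance
      (fun (g : Lp ℝ M.q (M.P n)) (f : Lp ℝ M.p (M.P n)) => ∫ z, f z * g z ∂(M.P n)) :=
    continuous_induced_dom
  have hd : @Continuous _ _ inferInstance (weakStarLq M.p M.q (M.P n))
      (Amb.density : M.Amb n → Lp ℝ M.q (M.P n)) := continuous_induced_dom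
  exact (continuous_apply _).comp (@Continuous.comp _ _ _ _ (weakStarLq M.p M.q (M.P n)) _ _ _
    hc hd)

/-! ### Policies -/

/-- Feasible histories: `aₖ ∈ Dₖ(xₖ)` for all `k < n`. -/
def Feasible {n : ℕ} (h : Hist A n) : Prop :=
  ∀ k : Fin n, (h.1 k.castSucc, h.2 k) ∈ M.D k

/-- Randomized, history-dependent policies of the controller (the set `Π^R`). -/
structure RandPolicy where
  kernel : ∀ n, Kernel (Hist A n) A
  isMarkovKernel : ∀ n, IsMarkovKernel (kernel n)
  admissible : ∀ n (h : Hist A n), M.Feasible h → kernel n h {a | (h.last, a) ∈ M.D n} = 1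

/-- Policies of nature (the set `Γ`): measurable maps `(hₙ, aₙ) ↦ γₙ(hₙ, aₙ) ∈ 𝒬ₙ₊₁`. -/
structure NaturePolicy where
  rule : ∀ n, Hist A n × A → M.Amb (n + 1)
  measurable_rule : ∀ n, Measurable (rule n)

/-- Deterministic Markov policies of the controller (the set `Π^M`). -/
structure MarkovPolicy where
  d : ℕ → ℝ → A
  measurable_d : ∀ n, Measurable (d n)
  admissible : ∀ n x, (x, d n x) ∈ M.D n

/-- Markov policies of nature (the set `Γ^M`); only the values on `D n` matter. -/
structure MarkovNature where
  rule : ∀ n, ℝ × A → M.Amb (n + 1)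
  measurable_rule : ∀ n, Measurable (rule n)

variable {M}

instance (π : M.RandPolicy) (n : ℕ) : IsMarkovKernel (π.kernel n) := π.isMarkovKernel n

/-- A deterministic Markov policy as a randomized policy, through Dirac kernels. -/
def MarkovPolicy.toRand (π : M.MarkovPolicy) : M.RandPolicy where
  kernel n := Kernel.deterministic (fun h : Hist A n => π.d n h.last)
    ((π.measurable_d n).comp Hist.measurable_last)
  isMarkovKernel _ := inferInstance
  admissible n h _ := by
    have hs : MeasurableSet {a : A | (h.last, a) ∈ M.D n} :=
      measurable_prodMk_left (M.measurableSet_D n)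
    rw [Kernel.deterministic_apply' _ _ hs]
    exact Set.indicator_of_mem (M := ℝ≥0∞) (s := {a : A | (h.last, a) ∈ M.D n})
      (π.admissible n h.last) (fun _ => 1)

/-- A Markov policy of nature as a policy of nature. -/
def MarkovNature.toNature (γ : M.MarkovNature) : M.NaturePolicy where
  rule n w := γ.rule n (w.1.last, w.2)
  measurable_rule n := (γ.measurable_rule n).comp
    ((Hist.measurable_last.comp measurable_fst).prodMk measurable_snd)

/-- The stochastic kernel `γₙ(dz | hₙ, aₙ)` induced by a decision rule of nature. -/
def NaturePolicy.kernel (γ : M.NaturePolicy) (n : ℕ) : Kernel (Hist A n × A) Z :=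
  ⟨fun w => (γ.rule n w).measure, (Amb.measurable_measure M _).comp (γ.measurable_rule n)⟩

instance (γ : M.NaturePolicy) (n : ℕ) : IsMarkovKernel (γ.kernel n) :=
  ⟨fun w => inferInstanceAs (IsProbabilityMeasure (γ.rule n w).measure)⟩

/-! ### Law of motion and values of policies -/

variable (M)

/-- The transition kernel `Qₙ^γ(· | hₙ, aₙ)`: the law of `Tₙ(xₙ, aₙ, z)` under
`γₙ(dz | hₙ, aₙ)`. -/
def transKernel (γ : M.NaturePolicy) (n : ℕ) : Kernel (Hist A n × A) ℝ :=
  (Kernel.id ×ₖ γ.kernel n).map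
    fun w : (Hist A n × A) × Z => M.T n w.1.1.last w.1.2 w.2

/-- The conditional law of `Hₙ₊₁` given `Hₙ`: append an action drawn from `πₙ` and then a state
drawn from `Qₙ^γ`. -/
def stepKernel (π : M.RandPolicy) (γ : M.NaturePolicy) (n : ℕ) :
    Kernel (Hist A n) (Hist A (n + 1)) :=
  (Kernel.id ×ₖ (π.kernel n ⊗ₖ M.transKernel γ n)).map
    fun w : Hist A n × (A × ℝ) => w.1.snoc w.2.1 w.2.2

/-- The conditional law of `H_k` given `Hₙ = hₙ` (for `n ≤ k`), that is
`δ_{hₙ} ⊗ πₙ ⊗ Qₙ^γ ⊗ ⋯ ⊗ πₖ₋₁ ⊗ Qₖ₋₁^γ`. -/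
def histLaw (π : M.RandPolicy) (γ : M.NaturePolicy) (n k : ℕ) (hnk : n ≤ k) :
    Kernel (Hist A n) (Hist A k) :=
  Nat.leRec (motive := fun k _ => Kernel (Hist A n) (Hist A k)) Kernel.id
    (fun j _ κ => M.stepKernel π γ j ∘ₖ κ) hnk

/-- The cost `∑_{k=n}^{N-1} cₖ(xₖ, aₖ, xₖ₊₁) + c_N(x_N)` of a history up to time `N`. -/
def totalCost (n : ℕ) (h : Hist A M.N) : ℝ :=
  (∑ k ∈ Finset.univ.filter (fun k : Fin M.N => n ≤ k), M.c k (h.1 k.castSucc) (h.2 k) (h.1 k.succ)) + M.cN h.last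

/-- The value `V_{nπγ}(hₙ)` of a policy pair. -/
def policyValue (π : M.RandPolicy) (γ : M.NaturePolicy) (n : ℕ) (hn : n ≤ M.N)
    (h : Hist A n) : ℝ :=
  ∫ ω, M.totalCost n ω ∂(M.histLaw π γ n M.N hn h)

/-- The robust value `V_{nπ}(hₙ) = sup_{γ ∈ Γ} V_{nπγ}(hₙ)`. -/
def robustPolicyValue (π : M.RandPolicy) (n : ℕ) (hn : n ≤ M.N) (h : Hist A n) : ℝ :=
  ⨆ γ : M.NaturePolicy, M.policyValue π γ n hn h

/-- The value function `Vₙ(hₙ) = inf_{π ∈ Π^R} sup_{γ ∈ Γ} V_{nπγ}(hₙ)`. -/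
def valueFun (n : ℕ) (hn : n ≤ M.N) (h : Hist A n) : ℝ :=
  ⨅ π : M.RandPolicy, M.robustPolicyValue π n hn h

/-- The value `J_{nπγ}(x) = E_{nx}[∑_{k=n}^{N-1} cₖ(Xₖ, Aₖ, Xₖ₊₁) + c_N(X_N)]` of a pair of Markov
policies started at time `n` in state `x`. As the future depends on the history only through the
current state, the process may be started from any feasible history that ends in `x`; the one
used here has always been in `x`. -/
def markovValue (π : M.MarkovPolicy) (γ : M.MarkovNature) (n : ℕ) (hn : n ≤ M.N) (x : ℝ) : ℝ :=
  M.policyValue π.toRand γ.toNature n hn (fun _ => x, fun k => π.d k x)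

/-- `J_{nπ}(x) = sup_{γ ∈ Γ^M} J_{nπγ}(x)`. -/
def robustMarkovValue (π : M.MarkovPolicy) (n : ℕ) (hn : n ≤ M.N) (x : ℝ) : ℝ :=
  ⨆ γ : M.MarkovNature, M.markovValue π γ n hn x

/-- The Markovian value function `Jₙ(x) = inf_{π ∈ Π^M} sup_{γ ∈ Γ^M} J_{nπγ}(x)`. -/
def J (n : ℕ) (hn : n ≤ M.N) (x : ℝ) : ℝ :=
  ⨅ π : M.MarkovPolicy, M.robustMarkovValue π n hn x

/-! ### Operators -/

/-- `Lₙ v(x, a, Q) = ∫ cₙ(x, a, Tₙ(x, a, z)) + v(Tₙ(x, a, z)) Q(dz)`. -/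
def L (n : ℕ) (v : ℝ → ℝ) (x : ℝ) (a : A) (Q : M.Amb (n + 1)) : ℝ :=
  ∫ z, (M.c n x a (M.T n x a z) + v (M.T n x a z)) ∂Q.measure

/-- `𝒯_{ndγ} v(x) = Lₙ v(x, d(x), γ(x, d(x)))`. -/
def opPair (n : ℕ) (d : ℝ → A) (γ : ℝ × A → M.Amb (n + 1)) (v : ℝ → ℝ) (x : ℝ) : ℝ :=
  M.L n v x (d x) (γ (x, d x))

/-- `𝒯_{nd} v(x) = sup_{Q ∈ 𝒬ₙ₊₁} Lₙ v(x, d(x), Q)`. -/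
def opRule (n : ℕ) (d : ℝ → A) (v : ℝ → ℝ) (x : ℝ) : ℝ :=
  ⨆ Q : M.Amb (n + 1), M.L n v x (d x) Q

/-- `𝒯ₙ v(x) = inf_{a ∈ Dₙ(x)} sup_{Q ∈ 𝒬ₙ₊₁} Lₙ v(x, a, Q)`. -/
def op (n : ℕ) (v : ℝ → ℝ) (x : ℝ) : ℝ :=
  ⨅ a : {a : A // (x, a) ∈ M.D n}, ⨆ Q : M.Amb (n + 1), M.L n v x a Q

/-- `π = (d₀, …, d_{N-1})` consists of minimizers: `𝒯_{n dₙ} Jₙ₊₁ = 𝒯ₙ Jₙ₊₁` for `n < N`. -/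
def IsMinimizing (π : M.MarkovPolicy) : Prop :=
  ∀ n (hn : n < M.N) x, M.opRule n (π.d n) (M.J (n + 1) hn) x = M.op n (M.J (n + 1) hn) x

/-- `γ = (γ₀, …, γ_{N-1})` consists of maximizers in response to `π`:
`Jₙ = 𝒯_{n dₙ γₙ} Jₙ₊₁` for `n < N`. -/
def IsMaximizing (π : M.MarkovPolicy) (γ : M.MarkovNature) : Prop :=
  ∀ n (hn : n < M.N) x,
    M.J n hn.le x = M.opPair n (π.d n) (γ.rule n) (M.J (n + 1) hn) x

/-! ### Assumptions -/

/-- Integrability assumptions. The expectations in the bounds are integrals of nonnegative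
functions, taken with values in `[0, ∞]`; e.g. `E^Q[-cₙ⁻] ≥ bl(x)` reads
`∫⁻ (-cₙ)⁺ dQ ≤ -bl(x)`. -/
structure Bounding (α εl εu : ℝ) (bl bu : ℝ → ℝ) : Prop where
  α_nonneg : 0 ≤ α
  α_ne_one : α ≠ 1
  εl_nonneg : 0 ≤ εl
  εu_nonneg : 0 ≤ εu
  ε_sum : εl + εu = 1
  measurable_bl : Measurable bl
  measurable_bu : Measurable bu
  bl_le : ∀ x, bl x ≤ -εl
  le_bu : ∀ x, εu ≤ bu x
  neg_cost : ∀ n < M.N, ∀ Q ∈ M.𝒬 (n + 1), ∀ x a, (x, a) ∈ M.D n →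
    ∫⁻ z, ENNReal.ofReal (-M.c n x a (M.T n x a z)) ∂Q ≤ ENNReal.ofReal (-bl x)
  neg_bound : ∀ n < M.N, ∀ Q ∈ M.𝒬 (n + 1), ∀ x a, (x, a) ∈ M.D n →
    ∫⁻ z, ENNReal.ofReal (-bl (M.T n x a z)) ∂Q ≤ ENNReal.ofReal (α * -bl x)
  pos_cost : ∀ n < M.N, ∀ Q ∈ M.𝒬 (n + 1), ∀ x a, (x, a) ∈ M.D n →
    ∫⁻ z, ENNReal.ofReal (M.c n x a (M.T n x a z)) ∂Q ≤ ENNReal.ofReal (bu x)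
  pos_bound : ∀ n < M.N, ∀ Q ∈ M.𝒬 (n + 1), ∀ x a, (x, a) ∈ M.D n →
    ∫⁻ z, ENNReal.ofReal (bu (M.T n x a z)) ∂Q ≤ ENNReal.ofReal (α * bu x)
  terminal : ∀ x, bl x ≤ M.cN x ∧ M.cN x ≤ bu x
  norm_bounded : ∃ K : ℝ, 1 ≤ K ∧ ∀ n, 1 ≤ n → n ≤ M.N → ∀ Q ∈ M.𝒬 n,
    eLpNorm (fun z => (Q.rnDeriv (M.P n) z).toReal) M.q (M.P n) ≤ ENNReal.ofReal K

/-- Local domination by `L^p` functions, with `b = bu - bl`. -/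
def LocallyDominated [TopologicalSpace A] (bl bu : ℝ → ℝ) : Prop :=
  ∀ n < M.N, ∀ w₀ ∈ M.D n, ∃ Θ₁ Θ₂ : Z → ℝ,
    Measurable Θ₁ ∧ Measurable Θ₂ ∧ (∀ z, 0 ≤ Θ₁ z) ∧ (∀ z, 0 ≤ Θ₂ z) ∧
    MemLp Θ₁ M.p (M.P (n + 1)) ∧ MemLp Θ₂ M.p (M.P (n + 1)) ∧
    ∀ᶠ w in 𝓝[M.D n] w₀, ∀ z,
      |M.c n w.1 w.2 (M.T n w.1 w.2 z)| ≤ Θ₁ z ∧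
      bu (M.T n w.1 w.2 z) - bl (M.T n w.1 w.2 z) ≤ Θ₂ z

/-- Compactness and lower semicontinuity assumptions. -/
structure Semicontinuous [TopologicalSpace A] : Prop where
  isCompact_D : ∀ n < M.N, ∀ x, IsCompact {a : A | (x, a) ∈ M.D n}
  /-- upper semicontinuity of `x ↦ Dₙ(x)` -/
  upperSemicontinuous_D : ∀ n < M.N, ∀ (xs : ℕ → ℝ) (as : ℕ → A) (x : ℝ),
    Tendsto xs atTop (𝓝 x) → (∀ k, (xs k, as k) ∈ M.D n) →
    ∃ a, (x, a) ∈ M.D n ∧ MapClusterPt a atTop as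
  lsc_T : ∀ n < M.N, ∀ z, LowerSemicontinuousOn (fun w : ℝ × A => M.T n w.1 w.2 z) (M.D n)
  lsc_c : ∀ n < M.N,
    LowerSemicontinuousOn (fun w : (ℝ × A) × ℝ => M.c n w.1.1 w.1.2 w.2) (M.D n ×ˢ Set.univ)
  lsc_cN : LowerSemicontinuous M.cN

/-- Monotonicity assumptions ("increasing" is meant in the weak sense). -/
structure MonotoneData : Prop where
  antitone_D : ∀ n < M.N, ∀ x x', x ≤ x' → {a : A | (x', a) ∈ M.D n} ⊆ {a : A | (x, a) ∈ M.D n}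
  monotone_T : ∀ n < M.N, ∀ a z, MonotoneOn (fun x => M.T n x a z) {x | (x, a) ∈ M.D n}
  monotone_c : ∀ n < M.N, ∀ a,
    MonotoneOn (fun w : ℝ × ℝ => M.c n w.1 a w.2) {w | (w.1, a) ∈ M.D n}
  monotone_cN : Monotone M.cN

end RobustMDP

/-- The set `𝔹` of lower semicontinuous, increasing functions `v : ℝ → ℝ` that are measurable and
satisfy `|v| ≤ λ b` for some `λ ≥ 0`. -/
def potentialValueFunctions (b : ℝ → ℝ) : Set (ℝ → ℝ) :=
  {v | Measurable v ∧ (∃ lam : ℝ, 0 ≤ lam ∧ ∀ x, |v x| ≤ lam * b x) ∧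
    LowerSemicontinuous v ∧ Monotone v}

end

/-! Let `W` denote the result of value iteration (`iteratedOp`): Bellman operators applied backwards
to the terminal cost. Both value functions are squeezed onto `W`. Nature moves after seeing the
action, so no minimax theorem is needed, only good measurable choices on each side.

From above: if each `dₙ` minimizes `sup_Q L`, the expected cost is at most `W` against every policy
of nature, since whatever nature plays after a history is one of the `Q` in the supremum
(`Bounding.backwardValue_le_iteratedOp`). From below: a Markov policy of nature that is `ε`-maximal
at every admissible pair, chosen without reference to the controller, forces a cost of at least `W -
mε` over `m` stages on every randomized history-dependent policy
(`Bounding.iteratedOp_le_backwardValue`). As the good policies on both sides are Markov, the same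
two bounds identify `V` and `J` (`Bounding.values_eq`). Expectations under the law of the whole
history are reduced to one-stage integrals by `Bounding.integrable_partialCost`.

For the choices to exist, `W` has to stay in `𝔹`. Monotonicity compensates for `T` being merely
lower semicontinuous (`lowerSemicontinuousOn_integrand`), Fatou's lemma carries lower semicontinuity
through the integral, and compactness with upper semicontinuity of `D` carries it through the
minimum and gives measurable minimizers (`isClosed_setOf_exists_le`, `exists_measurable_argmin`).
For fixed `(x, a)`, `L` is weak* continuous in `Q`, and norm bounded ambiguity sets are separable
metrizable because `L^p` is separable (`NormBounded.exists_isEmbedding`); hence measurable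
`ε`-maximizers exist. Exact maximizers need weak* compactness, which closedness supplies
(`NormBounded.compactSpace`). -/

/-! ### Measurable selection -/

/-- Kuratowski–Ryll-Nardzewski selection for compact-valued correspondences. -/
theorem exists_measurable_selection_of_isCompact {X Y : Type*} [MeasurableSpace X]
    [TopologicalSpace Y] [TopologicalSpace.MetrizableSpace Y] [SecondCountableTopology Y]
    [MeasurableSpace Y] [BorelSpace Y] (S : X → Set Y) (hc : ∀ x, IsCompact (S x))
    (hne : ∀ x, (S x).Nonempty)
    (hm : ∀ F : Set Y, IsClosed F → MeasurableSet {x | (S x ∩ F).Nonempty}) :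
    ∃ s : X → Y, Measurable s ∧ ∀ x, s x ∈ S x := by
  rcases isEmpty_or_nonempty X with hX | ⟨⟨x₀⟩⟩
  · exact ⟨fun x => isEmptyElim x, measurable_of_empty _, fun x => isEmptyElim x⟩
  have hY : Nonempty Y := ⟨(hne x₀).some⟩
  let _ := TopologicalSpace.metrizableSpaceMetric Y
  let Good : (X → Set Y) → Prop := fun S => (∀ x, IsCompact (S x)) ∧ (∀ x, (S x).Nonempty) ∧
    ∀ F : Set Y, IsClosed F → MeasurableSet {x | (S x ∩ F).Nonempty}
  -- The values can be cut down to radius `ε` without leaving the class: take as centre the first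
  -- point of a dense sequence whose ball meets `S x`. The first index is measurable because balls
  -- are closed.
  have step : ∀ S, Good S → ∀ ε : ℝ, 0 < ε →
      ∃ c : X → Y, Measurable c ∧ Good fun x => S x ∩ Metric.closedBall (c x) ε := by
    classical
    rintro S ⟨h1, h2, h3⟩ ε hε
    let y := TopologicalSpace.denseSeq Y
    have hex : ∀ x, ∃ i, (S x ∩ Metric.closedBall (y i) ε).Nonempty := by
      intro x
      obtain ⟨w, hw⟩ := h2 x
      obtain ⟨i, hi⟩ := (TopologicalSpace.denseRange_denseSeq Y).exists_dist_lt w hε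
      exact ⟨i, w, hw, hi.le⟩
    have hmi : Measurable fun x => Nat.find (hex x) :=
      measurable_find hex fun i => h3 _ Metric.isClosed_closedBall
    refine ⟨fun x => y (Nat.find (hex x)), (measurable_from_top (f := y)).comp hmi,
      fun x => (h1 x).inter_right Metric.isClosed_closedBall, fun x => Nat.find_spec (hex x), ?_⟩
    intro F hF
    have : {x | (S x ∩ Metric.closedBall (y (Nat.find (hex x))) ε ∩ F).Nonempty} =
        ⋃ i, {x | Nat.find (hex x) = i} ∩ {x | (S x ∩ (Metric.closedBall (y i) ε ∩ F)).Nonempty} := by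
      ext x
      simp [Set.inter_assoc]
    rw [this]
    exact MeasurableSet.iUnion fun i => (hmi (measurableSet_singleton i)).inter
      (h3 _ (Metric.isClosed_closedBall.inter hF))
  choose c hcm hcg using step
  have hpos : ∀ n : ℕ, (0 : ℝ) < (1 / 2) ^ n := fun n => by positivity
  -- Cutting down repeatedly with radii `(1/2)^n` leaves nonempty intersections by compactness, and
  -- the measurable centres converge to a point of the intersection.
  let R : ℕ → {S // Good S} := fun n => Nat.rec ⟨S, hc, hne, hm⟩
    (fun n T => ⟨_, hcg T.1 T.2 _ (hpos n)⟩) n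
  have hR : ∀ n, (R (n + 1)).1 = fun x => (R n).1 x ∩
      Metric.closedBall (c (R n).1 (R n).2 _ (hpos n) x) ((1 / 2) ^ n) := fun n => rfl
  have hint : ∀ x, (⋂ n, (R n).1 x).Nonempty := fun x =>
    IsCompact.nonempty_iInter_of_sequence_nonempty_isCompact_isClosed (fun n => (R n).1 x)
      (fun n => by rw [hR]; exact Set.inter_subset_left) (fun n => (R n).2.2.1 x) ((R 0).2.1 x)
      (fun n => ((R n).2.1 x).isClosed)
  choose s hs using hint
  have hs' : ∀ x n, s x ∈ (R n).1 x := fun x n => Set.mem_iInter.1 (hs x) n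
  refine ⟨s, ?_, fun x => hs' x 0⟩
  refine measurable_of_tendsto_metrizable
    (f := fun n x => c (R n).1 (R n).2 _ (hpos n) x) (fun n => hcm _ _ _ _) ?_
  rw [tendsto_pi_nhds]
  intro x
  rw [tendsto_iff_dist_tendsto_zero]
  refine squeeze_zero (fun _ => dist_nonneg) (fun n => ?_)
    (tendsto_pow_atTop_nhds_zero_of_lt_one (by norm_num : (0 : ℝ) ≤ 1 / 2) (by norm_num))
  have := hs' x (n + 1)
  rw [hR] at this
  rw [dist_comm]
  exact this.2

/-! ### The weak* topology on ambiguity sets -/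

theorem exists_abs_integral_Lp_mul_le {Z : Type*} [MeasurableSpace Z] (μ : Measure Z)
    (p q : ℝ≥0∞) [Fact (1 ≤ p)] [Fact (1 ≤ q)] [p.HolderConjugate q] :
    ∃ C : ℝ, 0 ≤ C ∧ ∀ (f : Lp ℝ p μ) (g : Lp ℝ q μ), |∫ z, f z * g z ∂μ| ≤ C * ‖f‖ * ‖g‖ := by
  refine ⟨‖(ContinuousLinearMap.mul ℝ ℝ).lpPairing μ p q‖, ContinuousLinearMap.opNorm_nonneg _,
    fun f g => ?_⟩
  have := ((ContinuousLinearMap.mul ℝ ℝ).lpPairing μ p q).le_opNorm₂ f g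
  rwa [ContinuousLinearMap.lpPairing_eq_integral] at this

namespace RobustMDP

variable {A : Type*} {Z : Type*} [MeasurableSpace A] [MeasurableSpace Z] {M : RobustMDP A Z}

theorem fact_one_le_p (M : RobustMDP A Z) : Fact (1 ≤ M.p) :=
  ⟨have := M.holderConjugate; ENNReal.HolderConjugate.one_le M.p M.q⟩

theorem fact_one_le_q (M : RobustMDP A Z) : Fact (1 ≤ M.q) := ⟨M.one_lt_q.le⟩

/-- Finiteness of `p` makes `L^p` separable and simple functions dense in it; both facts are needed
below. -/
theorem p_ne_top (M : RobustMDP A Z) : M.p ≠ ∞ := by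
  have := M.holderConjugate
  intro h
  have h1 := (ENNReal.HolderConjugate.inv_add_inv_eq_one M.p M.q)
  rw [h, ENNReal.inv_top, zero_add, ENNReal.inv_eq_one] at h1
  exact absurd h1 M.one_lt_q.ne'

theorem Amb.absolutelyContinuous {n : ℕ} (Q : M.Amb n) : Q.measure ≪ M.P n :=
  M.absolutelyContinuous_𝒬 n Q.1 Q.2

theorem Amb.integrable {n : ℕ} (Q : M.Amb n) {f : Z → ℝ} (hf : MemLp f M.p (M.P n)) :
    Integrable f Q.measure := by
  have := M.holderConjugate
  have hac := Q.absolutelyContinuous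
  rw [← integrable_toReal_rnDeriv_mul_iff hac]
  exact (M.memLp_𝒬 n Q.1 Q.2).integrable_mul hf

theorem Amb.integral_eq {n : ℕ} (Q : M.Amb n) {f : Z → ℝ} (hf : MemLp f M.p (M.P n)) :
    ∫ z, f z ∂Q.measure = ∫ z, hf.toLp f z * Q.density z ∂(M.P n) := by
  have hac := Q.absolutelyContinuous
  rw [← integral_toReal_rnDeriv_mul hac]
  refine integral_congr_ae ?_
  filter_upwards [hf.coeFn_toLp, (M.memLp_𝒬 n Q.1 Q.2).coeFn_toLp] with z h1 h2
  have h2' : Q.density z = (Q.measure.rnDeriv (M.P n) z).toReal := h2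
  rw [h1, h2', mul_comm]

theorem Amb.integral_Lp_eq {n : ℕ} (Q : M.Amb n) (f : Lp ℝ M.p (M.P n)) :
    ∫ z, f z ∂Q.measure = ∫ z, f z * Q.density z ∂(M.P n) := by
  rw [Q.integral_eq (Lp.memLp f), Lp.toLp_coeFn]

theorem Amb.continuous_integral_Lp {n : ℕ} (f : Lp ℝ M.p (M.P n)) :
    Continuous fun Q : M.Amb n => ∫ z, f z ∂Q.measure := by
  simp_rw [Amb.integral_Lp_eq]
  have hc : @Continuous _ _ (weakStarLq M.p M.q (M.P n)) inferInstance
      (fun (g : Lp ℝ M.q (M.P n)) (f : Lp ℝ M.p (M.P n)) => ∫ z, f z * g z ∂(M.P n)) :=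
    continuous_induced_dom
  have hd : @Continuous _ _ inferInstance (weakStarLq M.p M.q (M.P n))
      (Amb.density : M.Amb n → Lp ℝ M.q (M.P n)) := continuous_induced_dom
  exact (continuous_apply f).comp (@Continuous.comp _ _ _ _ (weakStarLq M.p M.q (M.P n)) _ _ _
    hc hd)

theorem Amb.continuous_integral {n : ℕ} {f : Z → ℝ} (hf : MemLp f M.p (M.P n)) :
    Continuous fun Q : M.Amb n => ∫ z, f z ∂Q.measure := by
  convert Amb.continuous_integral_Lp (hf.toLp f) using 2 with Q
  exact integral_congr_ae (Q.absolutelyContinuous.ae_eq hf.coeFn_toLp).symm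

theorem Amb.tendsto_nhds_iff {n : ℕ} {ι : Type*} {l : Filter ι} {u : ι → Lp ℝ M.q (M.P n)}
    {g : Lp ℝ M.q (M.P n)} :
    Tendsto u l (@nhds _ (weakStarLq M.p M.q (M.P n)) g) ↔ ∀ f : Lp ℝ M.p (M.P n),
      Tendsto (fun i => ∫ z, f z * u i z ∂(M.P n)) l (𝓝 (∫ z, f z * g z ∂(M.P n))) := by
  rw [nhds_induced, tendsto_comap_iff, tendsto_pi_nhds]
  rfl

/-- The densities of the measures in an ambiguity set are bounded in `L^q`. -/
def NormBounded (M : RobustMDP A Z) (n : ℕ) : Prop :=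
  ∃ K : ℝ, ∀ Q ∈ M.𝒬 n,
    eLpNorm (fun z => (Q.rnDeriv (M.P n) z).toReal) M.q (M.P n) ≤ ENNReal.ofReal K

theorem NormBounded.exists_abs_integral_le {n : ℕ} (h : M.NormBounded n) :
    ∃ C : ℝ, 0 ≤ C ∧ ∀ (Q : M.Amb n) (f : Lp ℝ M.p (M.P n)),
      |∫ z, f z ∂Q.measure| ≤ C * ‖f‖ := by
  have := M.holderConjugate
  have := M.fact_one_le_p
  have := M.fact_one_le_q
  obtain ⟨K, hK⟩ := h
  obtain ⟨C, hC, hle⟩ := exists_abs_integral_Lp_mul_le (M.P n) M.p M.q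
  -- `NormBounded` puts no sign condition on `K`.
  refine ⟨C * max K 0, by positivity, fun Q f => ?_⟩
  rw [Q.integral_Lp_eq]
  refine (hle f Q.density).trans ?_
  have : ‖Q.density‖ ≤ max K 0 := by
    rw [Amb.density, Lp.norm_toLp]
    refine ENNReal.toReal_le_of_le_ofReal (le_max_right _ _) ((hK Q.1 Q.2).trans ?_)
    exact ENNReal.ofReal_le_ofReal (le_max_left _ _)
  calc C * ‖f‖ * ‖Q.density‖ ≤ C * ‖f‖ * max K 0 := by gcongr
    _ = _ := by ring

/-- Under a norm bound, integrals depend on the test function in a Lipschitz way, uniformly in `Q`.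
Testing against a countable dense subset of `L^p` therefore already determines the weak* topology.
-/
theorem NormBounded.exists_isEmbedding {n : ℕ} (h : M.NormBounded n) :
    ∃ F : M.Amb n → ℕ → ℝ, IsEmbedding F := by
  have := M.fact_one_le_p
  have : Fact (M.p ≠ ∞) := ⟨M.p_ne_top⟩
  have := M.isSeparable_P n
  obtain ⟨C, hC, hle⟩ := h.exists_abs_integral_le
  let e := TopologicalSpace.denseSeq (Lp ℝ M.p (M.P n))
  let F : M.Amb n → ℕ → ℝ := fun Q k => ∫ z, e k z ∂Q.measure
  have hF : Continuous F := continuous_pi fun k => Amb.continuous_integral_Lp (e k)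
  have hsub : ∀ (Q : M.Amb n) (f g : Lp ℝ M.p (M.P n)),
      |(∫ z, f z ∂Q.measure) - ∫ z, g z ∂Q.measure| ≤ C * ‖f - g‖ := by
    intro Q f g
    rw [← integral_sub (Q.integrable (Lp.memLp f)) (Q.integrable (Lp.memLp g))]
    convert hle Q (f - g) using 2
    refine integral_congr_ae ?_
    filter_upwards [Q.absolutelyContinuous.ae_le (Lp.coeFn_sub f g)] with z hz
    exact hz.symm
  have hind : IsInducing F := by
    refine ⟨le_antisymm hF.le_induced ?_⟩
    change TopologicalSpace.induced F _ ≤ TopologicalSpace.induced Amb.density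
      (TopologicalSpace.induced _ _)
    rw [induced_compose, ← continuous_iff_le_induced]
    refine @continuous_pi _ _ _ (TopologicalSpace.induced F inferInstance) _ _ fun f => ?_
    simp only [Function.comp_def, ← Amb.integral_Lp_eq]
    let _ : TopologicalSpace (M.Amb n) := TopologicalSpace.induced F inferInstance
    -- The integral of `f` is a uniform limit of coordinates of `F`, hence continuous for the
    -- topology induced by `F`. The tolerance uses `C + 1` because `C` may vanish.
    refine continuous_of_uniform_approx_of_continuous fun u hu => ?_
    obtain ⟨ε, hε, hu⟩ := Metric.mem_uniformity_dist.1 hu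
    obtain ⟨k, hk⟩ := (TopologicalSpace.denseRange_denseSeq (Lp ℝ M.p (M.P n))).exists_dist_lt f
      (show 0 < ε / (C + 1) by positivity)
    refine ⟨fun Q => F Q k, (continuous_apply k).comp (continuous_induced_dom (f := F)),
      fun Q => hu ?_⟩
    rw [Real.dist_eq]
    refine (hsub Q f (e k)).trans_lt ?_
    rw [dist_eq_norm, lt_div_iff₀ (by positivity)] at hk
    have : 0 ≤ ‖f - e k‖ := norm_nonneg _
    change ‖f - e k‖ * (C + 1) < ε at hk
    nlinarith
  refine ⟨F, hind, fun Q Q' hQ => ?_⟩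
  -- Inseparable measures have equal integrals of all `L^p` functions, in particular of indicators.
  have hins : Inseparable Q Q' := hind.inseparable_iff.1 (by rw [hQ])
  refine Subtype.ext (Measure.ext fun B hB => ?_)
  have hm : MemLp (B.indicator fun _ => (1 : ℝ)) M.p (M.P n) :=
    memLp_indicator_const _ hB _ (Or.inr (measure_ne_top _ _))
  have := (hins.map (Amb.continuous_integral hm)).eq
  simp only [integral_indicator hB, integral_const, smul_eq_mul, mul_one,
    measureReal_restrict_apply_univ] at this
  have h1 : IsProbabilityMeasure Q.measure := inferInstance
  have h2 : IsProbabilityMeasure Q'.measure := inferInstance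
  exact (measureReal_eq_measureReal_iff (measure_ne_top Q.measure B)
    (measure_ne_top Q'.measure B)).1 this

theorem NormBounded.secondCountableTopology {n : ℕ} (h : M.NormBounded n) :
    SecondCountableTopology (M.Amb n) :=
  let ⟨_, hF⟩ := h.exists_isEmbedding
  hF.isInducing.secondCountableTopology

theorem NormBounded.metrizableSpace {n : ℕ} (h : M.NormBounded n) :
    TopologicalSpace.MetrizableSpace (M.Amb n) :=
  let ⟨_, hF⟩ := h.exists_isEmbedding
  hF.metrizableSpace

end RobustMDP

/-! ### Weak* compactness of norm bounded closed ambiguity sets -/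

open scoped NNReal in
/-- A nonnegative function that pairs boundedly with nonnegative functions in `L^p` is in `L^q`. -/
theorem memLp_of_lintegral_mul_le {Z : Type*} [MeasurableSpace Z] {μ : Measure Z}
    [IsFiniteMeasure μ] {p q : ℝ≥0∞} (hpq : p.HolderConjugate q) (hq : 1 < q) {g : Z → ℝ≥0}
    (hg : Measurable g) {C : ℝ≥0}
    (h : ∀ f : Z → ℝ≥0, Measurable f →
      ∫⁻ z, f z * g z ∂μ ≤ C * eLpNorm (fun z => (f z : ℝ)) p μ) :
    MemLp (fun z => (g z : ℝ)) q μ := by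
  classical
  have hsum := ENNReal.HolderConjugate.inv_add_inv_eq_one p q
  rcases eq_or_ne q ∞ with rfl | hqt
  · have hp : p = 1 := by simpa using hsum
    subst hp
    -- For `q = ∞` the exponent `p` is 1, and testing with indicators bounds `g` by `C` almost
    -- everywhere.
    have hle : (fun z => (g z : ℝ≥0∞)) ≤ᵐ[μ] fun _ => (C : ℝ≥0∞) := by
      refine ae_le_of_forall_setLIntegral_le_of_sigmaFinite hg.coe_nnreal_ennreal fun s hs _ => ?_
      have := h (s.indicator fun _ => 1) (measurable_const.indicator hs)
      have h1 : (fun z => ((s.indicator (fun _ => (1 : ℝ≥0)) z : ℝ≥0) : ℝ)) =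
          s.indicator fun _ => (1 : ℝ) := by
        ext z; by_cases hz : z ∈ s <;> simp [hz]
      rw [h1, eLpNorm_indicator_const hs one_ne_zero ENNReal.one_ne_top] at this
      rw [← lintegral_indicator hs, setLIntegral_const]
      convert this using 1
      · refine lintegral_congr fun z => ?_
        by_cases hz : z ∈ s <;> simp [hz]
      · simp
    refine MemLp.of_bound (by fun_prop) C ?_
    filter_upwards [hle] with z hz
    rw [Real.norm_of_nonneg (NNReal.coe_nonneg _)]
    exact_mod_cast hz
  · have hp0 : p ≠ 0 := ENNReal.HolderConjugate.ne_zero p q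
    have hpt : p ≠ ∞ := by
      rintro rfl
      rw [ENNReal.inv_top, zero_add, ENNReal.inv_eq_one] at hsum
      exact hq.ne' hsum
    have hq0 : q ≠ 0 := (zero_lt_one.trans hq).ne'
    have hr : p.toReal.HolderConjugate q.toReal := by
      rw [Real.holderConjugate_iff]
      have hq1 : 1 < q.toReal := by
        rw [← ENNReal.toReal_one]; exact (ENNReal.toReal_lt_toReal (by simp) hqt).2 hq
      have h2 : p.toReal⁻¹ + q.toReal⁻¹ = 1 := by
        rw [← ENNReal.toReal_inv, ← ENNReal.toReal_inv,
          ← ENNReal.toReal_add (by simpa using hp0) (by simpa using hq0), hsum, ENNReal.toReal_one]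
      have hpp : 0 < p.toReal := ENNReal.toReal_pos hp0 hpt
      refine ⟨?_, h2⟩
      have : 0 < q.toReal⁻¹ := by positivity
      have h3 : p.toReal⁻¹ < 1 := by linarith
      exact (inv_lt_one₀ hpp).1 h3
    set P := p.toReal
    set R := q.toReal
    -- Test with `min(g, k)^(R-1)`, whose `P`-th power is `min(g, k)^R`. This gives `I ≤ C ·
    -- I^(1/P)`, and truncation makes `I` finite so that one may divide. Fatou's lemma removes the
    -- truncation afterwards.
    have key : ∀ k : ℕ, ∫⁻ z, ((min (g z) k : ℝ≥0) : ℝ≥0∞) ^ R ∂μ ≤ (C : ℝ≥0∞) ^ R := by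
      intro k
      set I := ∫⁻ z, ((min (g z) k : ℝ≥0) : ℝ≥0∞) ^ R ∂μ with hI
      have hIt : I ≠ ∞ := by
        refine ((lintegral_mono (g := fun _ => (k : ℝ≥0∞) ^ R) fun z => ?_).trans_lt ?_).ne
        · refine ENNReal.rpow_le_rpow ?_ hr.symm.nonneg
          exact_mod_cast min_le_right _ _
        · rw [lintegral_const]
          exact ENNReal.mul_lt_top (ENNReal.rpow_lt_top_of_nonneg hr.symm.nonneg (by simp))
            (measure_lt_top _ _)
      have h1 : I ≤ C * I ^ (1 / P) := by
        have := h (fun z => min (g z) k ^ (R - 1)) (by fun_prop)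
        rw [eLpNorm_eq_lintegral_rpow_enorm_toReal hp0 hpt] at this
        refine le_trans ?_ (this.trans (le_of_eq ?_))
        · refine lintegral_mono fun z => ?_
          have : (min (g z) k) ^ R ≤ (min (g z) k) ^ (R - 1) * g z := by
            calc (min (g z) k) ^ R = (min (g z) k) ^ (R - 1) * min (g z) k := by
                  conv_rhs => rw [← NNReal.rpow_add_one' (by simpa using hr.symm.ne_zero)]
                  simp
              _ ≤ _ := by gcongr; exact min_le_left _ _
          rw [← ENNReal.coe_rpow_of_nonneg _ hr.symm.nonneg, ← ENNReal.coe_mul]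
          exact ENNReal.coe_le_coe.2 this
        · congr 2
          refine lintegral_congr fun z => ?_
          have he : ‖(((min (g z) k) ^ (R - 1) : ℝ≥0) : ℝ)‖ₑ =
              (((min (g z) k) ^ (R - 1) : ℝ≥0) : ℝ≥0∞) := by
            rw [Real.enorm_of_nonneg (NNReal.coe_nonneg _), ENNReal.ofReal_coe_nnreal]
          change ‖(((min (g z) k) ^ (R - 1) : ℝ≥0) : ℝ)‖ₑ ^ P = _
          rw [he, ← ENNReal.coe_rpow_of_nonneg _ hr.nonneg, ← NNReal.rpow_mul,
            ← ENNReal.coe_rpow_of_nonneg _ hr.symm.nonneg]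
          congr 2
          have := hr.symm.sub_one_mul_conj
          linarith
      rcases eq_or_ne I 0 with h0 | h0
      · rw [h0]; exact zero_le
      have h2 : I ^ (1 / R) ≤ C := by
        have h3 : I ^ (1 / P) * I ^ (1 / R) = I := by
          rw [← ENNReal.rpow_add _ _ h0 hIt, one_div, one_div, hr.inv_add_inv_eq_one,
            ENNReal.rpow_one]
        have h4 : I ^ (1 / P) ≠ 0 := by simp [ENNReal.rpow_eq_zero_iff, h0, hIt]
        have h5 : I ^ (1 / P) ≠ ∞ := ENNReal.rpow_ne_top_of_nonneg (by simpa using hr.nonneg) hIt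
        have h6 : I ^ (1 / P) * I ^ (1 / R) ≤ I ^ (1 / P) * C := by rw [h3, mul_comm]; exact h1
        exact (ENNReal.mul_le_mul_iff_right h4 h5).1 h6
      calc I = (I ^ (1 / R)) ^ R := by
            rw [← ENNReal.rpow_mul, one_div_mul_cancel hr.symm.ne_zero, ENNReal.rpow_one]
        _ ≤ _ := ENNReal.rpow_le_rpow h2 hr.symm.nonneg
    refine ⟨by fun_prop, ?_⟩
    rw [eLpNorm_lt_top_iff_lintegral_rpow_enorm_lt_top hq0 hqt]
    have hlim : ∀ z, Tendsto (fun k : ℕ => ((min (g z) k : ℝ≥0) : ℝ≥0∞) ^ R) atTop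
        (𝓝 (‖(g z : ℝ)‖ₑ ^ R)) := by
      intro z
      obtain ⟨k₀, hk₀⟩ := exists_nat_ge (g z)
      refine tendsto_const_nhds.congr' ?_
      filter_upwards [eventually_ge_atTop k₀] with k hk
      rw [min_eq_left (hk₀.trans (by exact_mod_cast hk)),
        Real.enorm_of_nonneg (NNReal.coe_nonneg _), ENNReal.ofReal_coe_nnreal]
    calc ∫⁻ z, ‖(g z : ℝ)‖ₑ ^ R ∂μ
        = ∫⁻ z, liminf (fun k : ℕ => ((min (g z) k : ℝ≥0) : ℝ≥0∞) ^ R) atTop ∂μ :=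
          lintegral_congr fun z => (hlim z).liminf_eq.symm
      _ ≤ liminf (fun k : ℕ => ∫⁻ z, ((min (g z) k : ℝ≥0) : ℝ≥0∞) ^ R ∂μ) atTop :=
          lintegral_liminf_le fun k => by fun_prop
      _ ≤ liminf (fun _ : ℕ => (C : ℝ≥0∞) ^ R) atTop := liminf_le_liminf (.of_forall key)
      _ < ∞ := by
          rw [liminf_const]
          exact ENNReal.rpow_lt_top_of_nonneg hr.symm.nonneg (by simp)

/-- A setwise limit along an ultrafilter of uniformly absolutely continuous measures is a
measure. -/
theorem exists_measure_tendsto_of_le {ι Z : Type*} [MeasurableSpace Z] (U : Ultrafilter ι)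
    {μ : Measure Z} [IsFiniteMeasure μ] (Q : ι → Measure Z) {p C : ℝ≥0∞} (hp0 : p ≠ 0)
    (hpt : p ≠ ∞) (hC : C ≠ ∞)
    (h : ∀ i B, MeasurableSet B → Q i B ≤ C * μ B ^ (1 / p.toReal)) :
    ∃ ν : Measure Z, ∀ B, MeasurableSet B → Tendsto (fun i => Q i B) U (𝓝 (ν B)) := by
  have hlim : ∀ B : Set Z, ∃ m, Tendsto (fun i => Q i B) U (𝓝 m) := by
    intro B
    -- The values lie in the compact space `[0, ∞]`.
    obtain ⟨m, -, hm⟩ := isCompact_univ.ultrafilter_le_nhds (U.map fun i => Q i B) (by simp)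
    exact ⟨m, hm⟩
  choose m hm using hlim
  have hle : ∀ B, MeasurableSet B → m B ≤ C * μ B ^ (1 / p.toReal) := fun B hB =>
    le_of_tendsto (hm B) (.of_forall fun i => h i B hB)
  have hpp : 0 < 1 / p.toReal := by have := ENNReal.toReal_pos hp0 hpt; positivity
  refine ⟨Measure.ofMeasurable (fun B _ => m B)
    (tendsto_nhds_unique (hm ∅) (by simp)) ?_, fun B hB => by
      rw [Measure.ofMeasurable_apply B hB]; exact hm B⟩
  intro f hf hd
  have hR : ∀ k : ℕ, MeasurableSet (⋃ i, f (i + k)) := fun k => .iUnion fun i => hf _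
  -- Finite additivity survives the limit. Countable additivity follows because the tail is bounded
  -- by a positive power of its `μ`-measure, uniformly along the ultrafilter.
  have h1 : ∀ k, m (⋃ i, f i) = (∑ i ∈ Finset.range k, m (f i)) + m (⋃ i, f (i + k)) := by
    intro k
    refine tendsto_nhds_unique (hm _) ((tendsto_finsetSum _ fun i _ => hm (f i)).add (hm _)
      |>.congr fun i => ?_)
    rw [measure_iUnion hd hf, measure_iUnion (f := fun j => f (j + k))
      (fun a b hab => hd (by simpa using hab)) fun i => hf _]
    exact ENNReal.summable.sum_add_tsum_nat_add'
  have h2 : Tendsto (fun k => μ (⋃ i, f (i + k))) atTop (𝓝 0) := by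
    have : ∀ k, μ (⋃ i, f (i + k)) = ∑' i, μ (f (i + k)) := fun k =>
      measure_iUnion (fun a b hab => hd (by simpa using hab)) fun i => hf _
    simp_rw [this]
    refine ENNReal.tendsto_sum_nat_add (fun i => μ (f i)) ?_
    rw [← measure_iUnion hd hf]
    exact measure_ne_top _ _
  have h3 : Tendsto (fun k => m (⋃ i, f (i + k))) atTop (𝓝 0) := by
    refine tendsto_of_tendsto_of_tendsto_of_le_of_le tendsto_const_nhds ?_ (fun _ => zero_le)
      (fun k => hle _ (hR k))
    have := ENNReal.Tendsto.const_mul (a := C)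
      ((ENNReal.continuous_rpow_const (y := 1 / p.toReal)).tendsto 0 |>.comp h2) (Or.inr hC)
    simpa [ENNReal.zero_rpow_of_pos hpp, Function.comp_def, hpp, ENNReal.toReal_pos hp0 hpt] using this
  have h4 := (ENNReal.tendsto_nat_tsum fun i => m (f i)).add h3
  rw [add_zero] at h4
  exact tendsto_nhds_unique (tendsto_const_nhds.congr h1) h4

theorem tendsto_lintegral_simpleFunc {ι Z : Type*} [MeasurableSpace Z] {l : Filter ι}
    {Q : ι → Measure Z} {ν : Measure Z}
    (h : ∀ B, MeasurableSet B → Tendsto (fun i => Q i B) l (𝓝 (ν B)))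
    (s : SimpleFunc Z NNReal) :
    Tendsto (fun i => ∫⁻ z, s z ∂(Q i)) l (𝓝 (∫⁻ z, s z ∂ν)) := by
  have : ∀ μ : Measure Z, ∫⁻ z, (s z : ℝ≥0∞) ∂μ = ∑ x ∈ s.range, x * μ (s ⁻¹' {x}) := by
    intro μ
    rw [← SimpleFunc.map_lintegral, ← SimpleFunc.lintegral_eq_lintegral]
    rfl
  simp_rw [this]
  exact tendsto_finsetSum _ fun x _ => ENNReal.Tendsto.const_mul (h _ (s.measurableSet_fiber x))
    (Or.inr ENNReal.coe_ne_top)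

namespace RobustMDP

variable {A : Type*} {Z : Type*} [MeasurableSpace A] [MeasurableSpace Z] {M : RobustMDP A Z}

theorem NormBounded.exists_lintegral_le {n : ℕ} (h : M.NormBounded n) :
    ∃ C : NNReal, (∀ (Q : M.Amb n) (f : Lp ℝ M.p (M.P n)), |∫ z, f z ∂Q.measure| ≤ C * ‖f‖) ∧
      ∀ (Q : M.Amb n) (f : Z → NNReal), MemLp (fun z => (f z : ℝ)) M.p (M.P n) →
      ∫⁻ z, f z ∂Q.measure ≤ C * eLpNorm (fun z => (f z : ℝ)) M.p (M.P n) := by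
  obtain ⟨C, hC, hle⟩ := h.exists_abs_integral_le
  refine ⟨⟨C, hC⟩, hle, fun Q f hf => ?_⟩
  have hac := Q.absolutelyContinuous
  have h1 : ∫⁻ z, f z ∂Q.measure = ENNReal.ofReal (∫ z, hf.toLp _ z ∂Q.measure) := by
    rw [integral_congr_ae (hac.ae_eq hf.coeFn_toLp),
      ofReal_integral_eq_lintegral_ofReal (Q.integrable hf) (.of_forall fun _ => NNReal.coe_nonneg _)]
    simp
  rw [h1]
  refine (ENNReal.ofReal_le_ofReal ((le_abs_self _).trans (hle Q _))).trans ?_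
  rw [ENNReal.ofReal_mul hC, Lp.norm_toLp, ENNReal.ofReal_toReal hf.2.ne]
  refine mul_le_mul_left (le_of_eq ?_) _
  exact ENNReal.ofReal_eq_coe_nnreal hC

/-- A concrete form of Banach–Alaoglu. Hölder's inequality on indicators makes the family uniformly
absolutely continuous, so setwise limits form a measure `ν`; the bound on pairings passes to `ν` and
puts its density in `L^q`; convergence then extends from indicators to `L^p` by density. -/
theorem NormBounded.exists_limit {n : ℕ} (h : M.NormBounded n) (U : Ultrafilter (M.Amb n)) :
    ∃ g : Lp ℝ M.q (M.P n), ∀ f : Lp ℝ M.p (M.P n),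
      Tendsto (fun Q : M.Amb n => ∫ z, f z ∂Q.measure) U (𝓝 (∫ z, f z * g z ∂(M.P n))) := by
  have := M.holderConjugate
  have := M.fact_one_le_p
  have := M.fact_one_le_q
  obtain ⟨C, hC, hle⟩ := h.exists_lintegral_le
  have hp0 : M.p ≠ 0 := ENNReal.HolderConjugate.ne_zero M.p M.q
  have hind : ∀ B, MeasurableSet B → MemLp (B.indicator fun _ => (1 : ℝ)) M.p (M.P n) :=
    fun B hB => memLp_indicator_const _ hB _ (Or.inr (measure_ne_top _ _))
  obtain ⟨ν, hν⟩ := exists_measure_tendsto_of_le U (μ := M.P n) (fun Q : M.Amb n => Q.measure)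
    (C := C) hp0 M.p_ne_top ENNReal.coe_ne_top (by
      intro Q B hB
      have hco : (fun z => ((B.indicator (fun _ => (1 : NNReal)) z : NNReal) : ℝ)) =
          B.indicator fun _ => (1 : ℝ) := by
        ext z; by_cases hz : z ∈ B <;> simp [hz]
      have := hle Q (B.indicator fun _ => 1) (by rw [hco]; exact hind B hB)
      rw [hco, eLpNorm_indicator_const hB hp0 M.p_ne_top] at this
      convert this using 1
      · rw [← lintegral_indicator_one hB]
        refine lintegral_congr fun z => ?_
        by_cases hz : z ∈ B <;> simp [hz]
      · simp)
  have hprob : IsProbabilityMeasure ν := ⟨tendsto_nhds_unique (hν _ .univ) (by simp)⟩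
  have hac : ν ≪ M.P n := by
    refine Measure.AbsolutelyContinuous.mk fun B hB h0 => tendsto_nhds_unique (hν B hB) ?_
    refine tendsto_const_nhds.congr fun Q => ?_
    exact (Q.absolutelyContinuous h0).symm
  -- Setwise convergence controls simple functions only, so the bound is obtained for simple
  -- functions below `f` and passed to the supremum.
  have hνle : ∀ f : Z → NNReal, Measurable f →
      ∫⁻ z, f z ∂ν ≤ C * eLpNorm (fun z => (f z : ℝ)) M.p (M.P n) := by
    intro f hf
    rw [lintegral_eq_nnreal]
    refine iSup₂_le fun s hs => ?_
    have hmem : MemLp (fun z => (s z : ℝ)) M.p (M.P n) :=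
      (s.map ((↑) : NNReal → ℝ)).memLp_of_isFiniteMeasure M.p (M.P n)
    rw [← SimpleFunc.lintegral_eq_lintegral, SimpleFunc.coe_map]
    refine (le_of_tendsto (tendsto_lintegral_simpleFunc hν s) (.of_forall fun Q =>
      hle Q s hmem)).trans ?_
    gcongr
    refine eLpNorm_mono_real fun z => ?_
    rw [Real.norm_of_nonneg (NNReal.coe_nonneg _)]
    exact_mod_cast hs z
  have hg : MemLp (fun z => (ν.rnDeriv (M.P n) z).toReal) M.q (M.P n) := by
    refine memLp_of_lintegral_mul_le M.holderConjugate M.one_lt_q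
      (g := fun z => (ν.rnDeriv (M.P n) z).toNNReal) (by fun_prop) (C := C) fun f hf => ?_
    refine le_trans (le_of_eq ?_) (hνle f hf)
    rw [← lintegral_rnDeriv_mul hac (by fun_prop)]
    refine lintegral_congr_ae ?_
    filter_upwards [ν.rnDeriv_ne_top (M.P n)] with z hz
    rw [ENNReal.coe_toNNReal hz, mul_comm]
  obtain ⟨C', hC', hle'⟩ := exists_abs_integral_Lp_mul_le (M.P n) M.p M.q
  refine ⟨hg.toLp _, fun f => ?_⟩
  induction f using Lp.induction M.p_ne_top with
  | indicatorConst c hs hμs =>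
    rename_i s
    have h1 : ∀ Q : M.Amb n, ∫ z, (Lp.simpleFunc.indicatorConst M.p hs hμs.ne c : Lp ℝ M.p (M.P n)) z
        ∂Q.measure = (Q.measure s).toReal * c := by
      intro Q
      rw [Lp.simpleFunc.coe_indicatorConst, integral_congr_ae
        (Q.absolutelyContinuous.ae_eq indicatorConstLp_coeFn), integral_indicator hs]
      simp [Measure.real]
    have h2 : ∫ z, (Lp.simpleFunc.indicatorConst M.p hs hμs.ne c : Lp ℝ M.p (M.P n)) z *
        hg.toLp _ z ∂(M.P n) = (ν s).toReal * c := by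
      have : ∫ z, (Lp.simpleFunc.indicatorConst M.p hs hμs.ne c : Lp ℝ M.p (M.P n)) z *
          hg.toLp _ z ∂(M.P n) = ∫ z, (ν.rnDeriv (M.P n) z).toReal * s.indicator (fun _ => c) z
            ∂(M.P n) := by
        refine integral_congr_ae ?_
        rw [Lp.simpleFunc.coe_indicatorConst]
        filter_upwards [indicatorConstLp_coeFn (p := M.p) (hs := hs) (hμs := hμs.ne) (c := c),
          hg.coeFn_toLp] with z h1 h2
        rw [h1, h2, mul_comm]
      rw [this, integral_toReal_rnDeriv_mul hac, integral_indicator hs]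
      simp [Measure.real]
    simp_rw [h1, h2]
    exact ((ENNReal.tendsto_toReal (measure_ne_top ν s)).comp (hν s hs)).mul_const c
  | add hf hg' hd h1 h2 =>
    rename_i f₁ f₂
    have e1 : ∀ Q : M.Amb n, ∫ z, (hf.toLp f₁ + hg'.toLp f₂) z ∂Q.measure =
        (∫ z, hf.toLp f₁ z ∂Q.measure) + ∫ z, hg'.toLp f₂ z ∂Q.measure := by
      intro Q
      rw [← integral_add (Q.integrable (Lp.memLp _)) (Q.integrable (Lp.memLp _))]
      exact integral_congr_ae (Q.absolutelyContinuous.ae_eq (Lp.coeFn_add _ _))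
    have e2 : ∫ z, (hf.toLp f₁ + hg'.toLp f₂) z * hg.toLp _ z ∂(M.P n) =
        (∫ z, hf.toLp f₁ z * hg.toLp _ z ∂(M.P n)) +
          ∫ z, hg'.toLp f₂ z * hg.toLp _ z ∂(M.P n) := by
      rw [← integral_add ((Lp.memLp _).integrable_mul (Lp.memLp _))
        ((Lp.memLp _).integrable_mul (Lp.memLp _))]
      refine integral_congr_ae ?_
      filter_upwards [Lp.coeFn_add (hf.toLp f₁) (hg'.toLp f₂)] with z hz
      rw [hz, Pi.add_apply]; ring
    simp_rw [e1, e2]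
    exact h1.add h2
  | isClosed =>
    set G := hg.toLp _
    refine isClosed_of_closure_subset fun f hf => ?_
    rw [Set.mem_ofPred_eq, Metric.tendsto_nhds]
    intro ε hε
    -- Replacing `f` by `f'` costs `C ‖f - f'‖` under every `Q` and `C' ‖f - f'‖ ‖G‖` in the limit;
    -- together these stay below `ε / 2`.
    obtain ⟨f', hf', hd⟩ := Metric.mem_closure_iff.1 hf (ε / (2 * (C + C' * ‖G‖ + 1)))
      (by positivity)
    have hbd : (C + C' * ‖G‖) * ‖f - f'‖ < ε / 2 := by
      rw [dist_eq_norm, lt_div_iff₀ (by positivity)] at hd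
      have : 0 ≤ ‖f - f'‖ := norm_nonneg _
      nlinarith
    filter_upwards [Metric.tendsto_nhds.1 hf' (ε / 2) (by positivity)] with Q hQ
    have h1 : |(∫ z, f z ∂Q.measure) - ∫ z, f' z ∂Q.measure| ≤ C * ‖f - f'‖ := by
      rw [← integral_sub (Q.integrable (Lp.memLp f)) (Q.integrable (Lp.memLp f'))]
      convert hC Q (f - f') using 2
      exact integral_congr_ae (Q.absolutelyContinuous.ae_eq (Lp.coeFn_sub f f')).symm
    have h2 : |(∫ z, f z * G z ∂(M.P n)) - ∫ z, f' z * G z ∂(M.P n)| ≤ C' * ‖f - f'‖ * ‖G‖ := by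
      rw [← integral_sub ((Lp.memLp _).integrable_mul (Lp.memLp _))
        ((Lp.memLp _).integrable_mul (Lp.memLp _))]
      convert hle' (f - f') G using 2
      refine integral_congr_ae ?_
      filter_upwards [Lp.coeFn_sub f f'] with z hz
      rw [hz, Pi.sub_apply]; ring
    rw [Real.dist_eq] at hQ ⊢
    rw [abs_lt] at *
    rw [abs_le] at h1 h2
    constructor <;> nlinarith [h1.1, h1.2, h2.1, h2.2]

/-- Norm bounded and weak* closed ambiguity sets are weak* compact. -/
theorem NormBounded.compactSpace {n : ℕ} (h : M.NormBounded n)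
    (hcl : IsClosed[weakStarLq M.p M.q (M.P n)]
      (Set.range (Amb.density : M.Amb n → Lp ℝ M.q (M.P n)))) : CompactSpace (M.Amb n) := by
  refine ⟨isCompact_iff_ultrafilter_le_nhds.2 fun U _ => ?_⟩
  obtain ⟨g, hg⟩ := h.exists_limit U
  simp_rw [Amb.integral_Lp_eq] at hg
  have ht : Tendsto Amb.density (U : Filter (M.Amb n))
      (@nhds _ (weakStarLq M.p M.q (M.P n)) g) := Amb.tendsto_nhds_iff.2 hg
  obtain ⟨Q, hQ⟩ : g ∈ Set.range (Amb.density : M.Amb n → Lp ℝ M.q (M.P n)) :=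
    @IsClosed.mem_of_tendsto _ (weakStarLq M.p M.q (M.P n)) _ _ _ _ _ _ hcl ht
      (.of_forall fun Q => Set.mem_range_self Q)
  refine ⟨Q, Set.mem_univ _, ?_⟩
  rw [← hQ] at ht
  change (U : Filter (M.Amb n)) ≤ @nhds _ (TopologicalSpace.induced _ _) Q
  rwa [@nhds_induced _ _ (weakStarLq M.p M.q (M.P n)), ← tendsto_iff_comap]

end RobustMDP

/-! ### Parametric optimization -/

theorem DenseRange.le_ciSup_of_continuous {ι Y : Type*} [TopologicalSpace Y] {e : ι → Y}
    (he : DenseRange e) {f : Y → ℝ} (hf : Continuous f) (hb : BddAbove (Set.range f)) (y : Y) :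
    f y ≤ ⨆ j, f (e j) := by
  refine he.induction_on (p := fun y => f y ≤ ⨆ j, f (e j)) y
    (isClosed_le hf continuous_const) fun j => ?_
  exact le_ciSup (f := fun j => f (e j)) (hb.mono (Set.range_comp_subset_range e f)) j

/-- By continuity the supremum may be taken along a dense sequence, so it is measurable in `x`, and
the first term of the sequence within `ε` of it is a measurable choice. -/
theorem exists_measurable_almost_argmax {X Y : Type*} [MeasurableSpace X] [TopologicalSpace Y]
    [TopologicalSpace.SeparableSpace Y] [Nonempty Y] [MeasurableSpace Y]
    (f : X → Y → ℝ) (hc : ∀ x, Continuous (f x)) (hm : ∀ y, Measurable fun x => f x y)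
    (hb : ∀ x, BddAbove (Set.range (f x))) {ε : ℝ} (hε : 0 < ε) :
    ∃ s : X → Y, Measurable s ∧ ∀ x y, f x y ≤ f x (s x) + ε := by
  classical
  let e := TopologicalSpace.denseSeq Y
  have he : DenseRange e := TopologicalSpace.denseRange_denseSeq Y
  have hex : ∀ x, ∃ k, (⨆ j, f x (e j)) < f x (e k) + ε := by
    intro x
    obtain ⟨k, hk⟩ := exists_lt_of_lt_ciSup (sub_lt_self (⨆ j, f x (e j)) hε)
    exact ⟨k, by linarith⟩
  have hmf : Measurable fun x => Nat.find (hex x) := measurable_find hex fun k =>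
    measurableSet_lt (Measurable.iSup fun j => hm (e j)) ((hm (e k)).add_const ε)
  refine ⟨fun x => e (Nat.find (hex x)), (measurable_from_top (f := e)).comp hmf, fun x y => ?_⟩
  exact (he.le_ciSup_of_continuous (hc x) (hb x) y).trans (Nat.find_spec (hex x)).le

/-- The set of maximizers is compact and meets a closed `F` exactly when the maximum over `F`
reaches the global one. Both maxima are suprema along dense sequences, so this is a measurable
condition on `x`. -/
theorem exists_measurable_argmax {X Y : Type*} [MeasurableSpace X] [TopologicalSpace Y]
    [TopologicalSpace.MetrizableSpace Y] [SecondCountableTopology Y] [CompactSpace Y] [Nonempty Y]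
    [MeasurableSpace Y] [BorelSpace Y]
    (f : X → Y → ℝ) (hc : ∀ x, Continuous (f x)) (hm : ∀ y, Measurable fun x => f x y) :
    ∃ s : X → Y, Measurable s ∧ ∀ x y, f x y ≤ f x (s x) := by
  let S : X → Set Y := fun x => {y | ∀ y', f x y' ≤ f x y}
  have hb : ∀ x, BddAbove (Set.range (f x)) := fun x => (isCompact_range (hc x)).bddAbove
  have hcl : ∀ x, IsClosed (S x) := fun x => by
    have : S x = ⋂ y', {y | f x y' ≤ f x y} := by ext; simp [S]
    rw [this]
    exact isClosed_iInter fun y' => isClosed_le continuous_const (hc x)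
  refine exists_measurable_selection_of_isCompact S (fun x => (hcl x).isCompact) (fun x => ?_)
    fun F hF => ?_
  · obtain ⟨y, -, hy⟩ := isCompact_univ.exists_isMaxOn Set.univ_nonempty (hc x).continuousOn
    exact ⟨y, fun y' => hy (Set.mem_univ y')⟩
  rcases F.eq_empty_or_nonempty with rfl | hne
  · simp
  have : Nonempty F := hne.to_subtype
  let e := TopologicalSpace.denseSeq Y
  have he : DenseRange e := TopologicalSpace.denseRange_denseSeq Y
  let e' := TopologicalSpace.denseSeq F
  have he' : DenseRange e' := TopologicalSpace.denseRange_denseSeq F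
  have : {x | (S x ∩ F).Nonempty} = {x | (⨆ j, f x (e j)) ≤ ⨆ j, f x (e' j)} := by
    ext x
    have hcF : Continuous fun y : F => f x y := (hc x).comp continuous_subtype_val
    have hbF : BddAbove (Set.range fun y : F => f x y) :=
      (hb x).mono (Set.range_comp_subset_range Subtype.val (f x))
    constructor
    · rintro ⟨y, hy, hyF⟩
      exact (ciSup_le fun j => hy (e j)).trans (he'.le_ciSup_of_continuous hcF hbF ⟨y, hyF⟩)
    · intro hx
      obtain ⟨y, hyF, hy⟩ := hF.isCompact.exists_isMaxOn hne (hc x).continuousOn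
      refine ⟨y, fun y' => ?_, hyF⟩
      exact (he.le_ciSup_of_continuous (hc x) (hb x) y').trans
        (le_trans hx (ciSup_le fun j => hy (e' j).2))
  rw [this]
  exact measurableSet_le (Measurable.iSup fun j => hm _) (Measurable.iSup fun j => hm _)

theorem LowerSemicontinuousOn.exists_forall_le_section
    {X A : Type*} [TopologicalSpace X] [TopologicalSpace A] {D : Set (X × A)} {w : X × A → ℝ}
    (hw : LowerSemicontinuousOn w D) {x : X} (hcomp : IsCompact {a | (x, a) ∈ D})
    {F : Set A} (hF : IsClosed F) (hne : ∃ a ∈ F, (x, a) ∈ D) :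
    ∃ a ∈ F, (x, a) ∈ D ∧ ∀ a' ∈ F, (x, a') ∈ D → w (x, a) ≤ w (x, a') := by
  have hl : LowerSemicontinuousOn (fun a => w (x, a)) ({a | (x, a) ∈ D} ∩ F) := by
    intro a ha y hy
    have hc : Tendsto (fun a' : A => (x, a')) (𝓝[{a | (x, a) ∈ D} ∩ F] a) (𝓝[D] (x, a)) :=
      tendsto_nhdsWithin_iff.2 ⟨(Continuous.prodMk_right x).continuousWithinAt,
        eventually_mem_nhdsWithin.mono fun _ h => h.1⟩
    exact hc.eventually (hw _ ha.1 y hy)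
  obtain ⟨a₀, h1, h2⟩ := hne
  obtain ⟨a, ⟨ha, haF⟩, hmin⟩ := hl.exists_isMinOn (s := {a | (x, a) ∈ D} ∩ F) ⟨a₀, h2, h1⟩
    (hcomp.inter_right hF)
  exact ⟨a, haF, ha, fun a' h h' => hmin ⟨h', h⟩⟩

section Minimization

variable {X A : Type*} [TopologicalSpace X] [FirstCountableTopology X] [TopologicalSpace A]
  [FirstCountableTopology A] {D : Set (X × A)} {w : X × A → ℝ}

/-- Upper semicontinuity of the sections yields an accumulation point of the chosen actions, and
lower semicontinuity keeps the bound there. With `F = univ` this gives lower semicontinuity of the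
minimum; general `F` is needed for measurable minimizers. -/
theorem isClosed_setOf_exists_le
    (hD : ∀ (xs : ℕ → X) (as : ℕ → A) (x : X), Tendsto xs atTop (𝓝 x) →
      (∀ k, (xs k, as k) ∈ D) → ∃ a, (x, a) ∈ D ∧ MapClusterPt a atTop as)
    (hw : LowerSemicontinuousOn w D) {F : Set A} (hF : IsClosed F) (r : ℝ) :
    IsClosed {x | ∃ a, (x, a) ∈ D ∧ a ∈ F ∧ w (x, a) ≤ r} := by
  refine IsSeqClosed.isClosed fun xs x hxs hx => ?_
  choose as h1 h2 h3 using hxs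
  obtain ⟨a, ha, hcl⟩ := hD xs as x hx h1
  obtain ⟨φ, hφ, hlim⟩ := hcl.tendsto_subseq
  refine ⟨a, ha, hF.mem_of_tendsto hlim (.of_forall fun k => h2 _), ?_⟩
  by_contra! hlt
  have ht : Tendsto (fun k => (xs (φ k), as (φ k))) atTop (𝓝[D] (x, a)) :=
    tendsto_nhdsWithin_iff.2 ⟨(hx.comp hφ.tendsto_atTop).prodMk_nhds hlim,
      .of_forall fun k => h1 _⟩
  obtain ⟨k, hk⟩ := (ht.eventually (hw _ ha r hlt)).exists
  exact absurd (h3 (φ k)) hk.not_ge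

/-- The minimizers at `x` miss a closed `F` exactly when some rational level is reached over the
whole section but not inside `F`. Such `x` form a countable union of differences of closed sets, so
the selection theorem applies. -/
theorem exists_measurable_argmin [MeasurableSpace X] [BorelSpace X]
    [TopologicalSpace.MetrizableSpace A] [SecondCountableTopology A] [MeasurableSpace A]
    [BorelSpace A]
    (hD : ∀ (xs : ℕ → X) (as : ℕ → A) (x : X), Tendsto xs atTop (𝓝 x) →
      (∀ k, (xs k, as k) ∈ D) → ∃ a, (x, a) ∈ D ∧ MapClusterPt a atTop as)
    (hcomp : ∀ x, IsCompact {a | (x, a) ∈ D}) (hne : ∀ x, ∃ a, (x, a) ∈ D)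
    (hw : LowerSemicontinuousOn w D) :
    ∃ d : X → A, Measurable d ∧ ∀ x, (x, d x) ∈ D ∧ ∀ a, (x, a) ∈ D → w (x, d x) ≤ w (x, a) := by
  have hmin : ∀ x, ∃ a, (x, a) ∈ D ∧ ∀ a', (x, a') ∈ D → w (x, a) ≤ w (x, a') := by
    intro x
    obtain ⟨a, -, ha, h⟩ := hw.exists_forall_le_section (hcomp x) isClosed_univ
      (by simpa using hne x)
    exact ⟨a, ha, fun a' ha' => h a' trivial ha'⟩
  choose d₀ hd₀ hle using hmin
  let S : X → Set A := fun x => {a | (x, a) ∈ D ∧ w (x, a) ≤ w (x, d₀ x)}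
  suffices h : ∃ d : X → A, Measurable d ∧ ∀ x, d x ∈ S x by
    obtain ⟨d, hd, hdS⟩ := h
    exact ⟨d, hd, fun x => ⟨(hdS x).1, fun a ha => (hdS x).2.trans (hle x a ha)⟩⟩
  refine exists_measurable_selection_of_isCompact S (fun x => ?_)
    (fun x => ⟨d₀ x, hd₀ x, le_rfl⟩) fun F hF => ?_
  · have hl : LowerSemicontinuousOn (fun a => w (x, a)) {a | (x, a) ∈ D} := by
      intro a ha y hy
      have hc : Tendsto (fun a' : A => (x, a')) (𝓝[{a | (x, a) ∈ D}] a) (𝓝[D] (x, a)) :=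
        tendsto_nhdsWithin_iff.2 ⟨(Continuous.prodMk_right x).continuousWithinAt,
          eventually_mem_nhdsWithin⟩
      exact hc.eventually (hw _ ha y hy)
    obtain ⟨v, hv, hv'⟩ := lowerSemicontinuousOn_iff_preimage_Iic.1 hl (w (x, d₀ x))
    have : S x = {a | (x, a) ∈ D} ∩ v := by rw [← hv']; rfl
    rw [this]
    exact (hcomp x).inter_right hv
  · rw [← MeasurableSet.compl_iff]
    have : {x | (S x ∩ F).Nonempty}ᶜ = ⋃ r : ℚ,
        {x | ∃ a, (x, a) ∈ D ∧ a ∈ Set.univ ∧ w (x, a) ≤ r} \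
          {x | ∃ a, (x, a) ∈ D ∧ a ∈ F ∧ w (x, a) ≤ r} := by
      ext x
      simp only [Set.mem_compl_iff, Set.mem_iUnion]
      constructor
      · intro hx
        by_cases hn : ∃ a ∈ F, (x, a) ∈ D
        · obtain ⟨a, haF, ha, hmin⟩ := hw.exists_forall_le_section (hcomp x) hF hn
          have hlt : w (x, d₀ x) < w (x, a) := by
            by_contra! h
            exact hx ⟨a, ⟨ha, h⟩, haF⟩
          obtain ⟨r, h1, h2⟩ := exists_rat_btwn hlt
          exact ⟨r, ⟨d₀ x, hd₀ x, trivial, h1.le⟩,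
            fun ⟨a', h3, h4, h5⟩ => absurd (h5.trans_lt h2) (hmin a' h4 h3).not_gt⟩
        -- If `F` misses the section altogether, any rational above the minimum will do.
        · obtain ⟨r, hr⟩ := exists_rat_gt (w (x, d₀ x))
          exact ⟨r, ⟨d₀ x, hd₀ x, trivial, hr.le⟩, fun ⟨a', h3, h4, _⟩ => hn ⟨a', h4, h3⟩⟩
      · rintro ⟨r, ⟨a, ha, -, har⟩, hr⟩ ⟨a', ⟨h1, h2⟩, h3⟩
        exact hr ⟨a', h1, h3, h2.trans ((hle x a ha).trans har)⟩
    rw [this]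
    exact .iUnion fun r => (isClosed_setOf_exists_le hD hw isClosed_univ r).measurableSet.diff
      (isClosed_setOf_exists_le hD hw hF r).measurableSet

end Minimization

/-- Fatou's lemma as lower semicontinuity of a parametric integral. -/
theorem lowerSemicontinuousOn_integral {W Z : Type*} [TopologicalSpace W]
    [FirstCountableTopology W] [MeasurableSpace Z] {μ : Measure Z} {s : Set W} {f : W → Z → ℝ}
    (hf : ∀ w ∈ s, Integrable (f w) μ) (hm : ∀ w, Measurable (f w))
    (hlsc : ∀ z, LowerSemicontinuousOn (fun w => f w z) s)
    (hdom : ∀ w₀ ∈ s, ∃ g : Z → ℝ, Measurable g ∧ Integrable g μ ∧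
      ∀ᶠ w in 𝓝[s] w₀, ∀ z, |f w z| ≤ g z) :
    LowerSemicontinuousOn (fun w => ∫ z, f w z ∂μ) s := by
  intro w₀ hw₀ y hy
  by_contra hcon
  obtain ⟨g, hgm, hg, hdom⟩ := hdom w₀ hw₀
  -- A failure yields a sequence on which the integrals stay at most `y`. Fatou's lemma is applied
  -- to `f + g ≥ 0` along it.
  have hfr : ∃ᶠ w in 𝓝[s] w₀, ((∫ z, f w z ∂μ) ≤ y ∧ w ∈ s) ∧ ∀ z, |f w z| ≤ g z := by
    refine Frequently.and_eventually ((not_eventually.1 hcon).mono fun w hw => ?_)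
      hdom |>.and_eventually eventually_mem_nhdsWithin |>.mono fun w h => ⟨⟨h.1.1, h.2⟩, h.1.2⟩
    exact not_lt.1 hw
  obtain ⟨u, hu, hu'⟩ := exists_seq_forall_of_frequently hfr
  have hpos : ∀ w, (∀ z, |f w z| ≤ g z) → ∀ z, 0 ≤ f w z + g z := fun w h z => by
    have := (abs_le.1 (h z)).1; linarith
  have h₀ : ∀ z, |f w₀ z| ≤ g z := hdom.self_of_nhdsWithin hw₀
  have key : ∫⁻ z, ENNReal.ofReal (f w₀ z + g z) ∂μ ≤ ENNReal.ofReal (y + ∫ z, g z ∂μ) := by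
    calc ∫⁻ z, ENNReal.ofReal (f w₀ z + g z) ∂μ
        ≤ ∫⁻ z, liminf (fun k => ENNReal.ofReal (f (u k) z + g z)) atTop ∂μ := by
          refine lintegral_mono fun z => ?_
          refine le_of_forall_lt fun c hc => ?_
          obtain ⟨c', hcc', hc'⟩ := exists_between hc
          refine hcc'.trans_le (le_liminf_of_le (by isBoundedDefault) ?_)
          have hct := hc'.ne_top
          rw [ENNReal.lt_ofReal_iff_toReal_lt hct] at hc'
          filter_upwards [hu.eventually (hlsc z w₀ hw₀ (c'.toReal - g z) (by linarith))] with k hk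
          refine ENNReal.le_ofReal_iff_toReal_le hct (hpos _ (hu' k).2 z) |>.2 ?_
          linarith
      _ ≤ liminf (fun k => ∫⁻ z, ENNReal.ofReal (f (u k) z + g z) ∂μ) atTop :=
          lintegral_liminf_le fun k => ((hm _).add hgm).ennreal_ofReal
      _ ≤ liminf (fun _ : ℕ => ENNReal.ofReal (y + ∫ z, g z ∂μ)) atTop := by
          refine liminf_le_liminf (.of_forall fun k => ?_)
          have hi := hf _ (hu' k).1.2
          rw [← ofReal_integral_eq_lintegral_ofReal (f := fun z => f (u k) z + g z) (hi.add hg)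
            (.of_forall fun z => hpos _ (hu' k).2 z), integral_add hi hg]
          refine ENNReal.ofReal_le_ofReal ?_
          linarith [(hu' k).1.1]
      _ = _ := liminf_const _
  have hi := hf _ hw₀
  rw [← ofReal_integral_eq_lintegral_ofReal (f := fun z => f w₀ z + g z) (hi.add hg)
    (.of_forall fun z => hpos _ h₀ z), integral_add hi hg] at key
  -- The sign is needed to undo `ENNReal.ofReal`; any member of the sequence supplies it.
  have h1 : 0 ≤ y + ∫ z, g z ∂μ := by
    have := (hu' 0).1.1
    have h2 : 0 ≤ ∫ z, (f (u 0) z + g z) ∂μ := integral_nonneg fun z => hpos _ (hu' 0).2 z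
    rw [integral_add (hf _ (hu' 0).1.2) hg] at h2
    linarith
  have := (ENNReal.ofReal_le_ofReal_iff h1).1 key
  linarith

/-! ### The one-stage operators -/

theorem integrable_and_integral_abs_le {Z : Type*} [MeasurableSpace Z] {Q : Measure Z}
    {f : Z → ℝ} (hf : Measurable f) {r s : ℝ} (hr : 0 ≤ r) (hs : 0 ≤ s)
    (h1 : ∫⁻ z, ENNReal.ofReal (f z) ∂Q ≤ ENNReal.ofReal r)
    (h2 : ∫⁻ z, ENNReal.ofReal (-f z) ∂Q ≤ ENNReal.ofReal s) :
    Integrable f Q ∧ ∫ z, |f z| ∂Q ≤ r + s := by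
  have h : ∫⁻ z, ‖f z‖ₑ ∂Q ≤ ENNReal.ofReal (r + s) := by
    have : ∀ z, ‖f z‖ₑ = ENNReal.ofReal (f z) + ENNReal.ofReal (-f z) := by
      intro z
      rw [Real.enorm_eq_ofReal_abs]
      rcases le_total 0 (f z) with h | h
      · rw [abs_of_nonneg h, ENNReal.ofReal_of_nonpos (by linarith : -f z ≤ 0), add_zero]
      · rw [abs_of_nonpos h, ENNReal.ofReal_of_nonpos h, zero_add]
    simp_rw [this]
    rw [lintegral_add_left hf.ennreal_ofReal, ENNReal.ofReal_add hr hs]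
    gcongr
  have hi : Integrable f Q := ⟨hf.aestronglyMeasurable, h.trans_lt ENNReal.ofReal_lt_top⟩
  refine ⟨hi, ?_⟩
  rw [← ENNReal.ofReal_le_ofReal_iff (by positivity)]
  refine le_trans (le_of_eq ?_) h
  rw [← ofReal_integral_norm_eq_lintegral_enorm hi]
  rfl

namespace RobustMDP

variable {A : Type*} {Z : Type*} [MeasurableSpace A] [MeasurableSpace Z] {M : RobustMDP A Z}
  {α εl εu : ℝ} {bl bu : ℝ → ℝ}

theorem measurable_T_right (M : RobustMDP A Z) (n : ℕ) (x : ℝ) (a : A) :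
    Measurable (M.T n x a) :=
  (M.measurable_T n).comp (measurable_prodMk_left (x := (x, a)))

theorem measurable_integrand (M : RobustMDP A Z) (n : ℕ) {v : ℝ → ℝ} (hv : Measurable v) :
    Measurable fun w : (ℝ × A) × Z =>
      M.c n w.1.1 w.1.2 (M.T n w.1.1 w.1.2 w.2) + v (M.T n w.1.1 w.1.2 w.2) :=
  ((M.measurable_c n).comp (measurable_fst.prodMk (M.measurable_T n))).add
    (hv.comp (M.measurable_T n))

theorem measurable_cost (M : RobustMDP A Z) (n : ℕ) (x : ℝ) (a : A) :
    Measurable fun z => M.c n x a (M.T n x a z) :=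
  (M.measurable_c n).comp ((measurable_const (a := (x, a))).prodMk (M.measurable_T_right n x a))

theorem measurable_L (M : RobustMDP A Z) (n : ℕ) {v : ℝ → ℝ} (hv : Measurable v)
    (Q : M.Amb (n + 1)) : Measurable fun w : ℝ × A => M.L n v w.1 w.2 Q :=
  ((M.measurable_integrand n hv).stronglyMeasurable.integral_prod_right').measurable

instance (n : ℕ) : Nonempty (M.Amb n) := (M.nonempty_𝒬 n).to_subtype

theorem exists_action (M : RobustMDP A Z) (n : ℕ) (x : ℝ) : ∃ a, (x, a) ∈ M.D n :=
  let ⟨d, _, hd⟩ := M.exists_graph n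
  ⟨d x, hd x⟩

namespace Bounding

variable (hb : M.Bounding α εl εu bl bu)
include hb

theorem bl_nonpos (x : ℝ) : bl x ≤ 0 := (hb.bl_le x).trans (by linarith [hb.εl_nonneg])

theorem bu_nonneg (x : ℝ) : 0 ≤ bu x := hb.εu_nonneg.trans (hb.le_bu x)

theorem one_le (x : ℝ) : 1 ≤ bu x - bl x := by
  linarith [hb.bl_le x, hb.le_bu x, hb.ε_sum]

theorem measurable_b : Measurable fun x => bu x - bl x := hb.measurable_bu.sub hb.measurable_bl

theorem abs_cN_le (x : ℝ) : |M.cN x| ≤ bu x - bl x := by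
  have := hb.terminal x
  rw [abs_le]
  constructor <;> linarith [hb.bl_nonpos x, hb.bu_nonneg x]

theorem normBounded {n : ℕ} (hn : n < M.N) : M.NormBounded (n + 1) :=
  let ⟨K, _, hK⟩ := hb.norm_bounded
  ⟨K, hK (n + 1) (by lia) hn⟩

theorem cost_bound {n : ℕ} (hn : n < M.N) {x : ℝ} {a : A} (hxa : (x, a) ∈ M.D n)
    (Q : M.Amb (n + 1)) : Integrable (fun z => M.c n x a (M.T n x a z)) Q.measure ∧
      ∫ z, |M.c n x a (M.T n x a z)| ∂Q.measure ≤ bu x - bl x := by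
  have := integrable_and_integral_abs_le (M.measurable_cost n x a) (hb.bu_nonneg x)
    (neg_nonneg.2 (hb.bl_nonpos x)) (hb.pos_cost n hn Q.1 Q.2 x a hxa)
    (hb.neg_cost n hn Q.1 Q.2 x a hxa)
  exact ⟨this.1, this.2.trans (by linarith)⟩

theorem bound_bound {n : ℕ} (hn : n < M.N) {x : ℝ} {a : A} (hxa : (x, a) ∈ M.D n)
    (Q : M.Amb (n + 1)) :
    Integrable (fun z => bu (M.T n x a z) - bl (M.T n x a z)) Q.measure ∧
      ∫ z, (bu (M.T n x a z) - bl (M.T n x a z)) ∂Q.measure ≤ α * (bu x - bl x) := by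
  have hT := M.measurable_T_right n x a
  have h1 := integrable_and_integral_abs_le (Q := Q.measure) (f := fun z => bu (M.T n x a z))
    (hb.measurable_bu.comp hT)
    (mul_nonneg hb.α_nonneg (hb.bu_nonneg x)) le_rfl (hb.pos_bound n hn Q.1 Q.2 x a hxa)
    (by simp [ENNReal.ofReal_of_nonpos, hb.bu_nonneg])
  have h2 := integrable_and_integral_abs_le (Q := Q.measure) (f := fun z => -bl (M.T n x a z))
    (hb.measurable_bl.comp hT).neg
    (mul_nonneg hb.α_nonneg (neg_nonneg.2 (hb.bl_nonpos x))) le_rfl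
    (hb.neg_bound n hn Q.1 Q.2 x a hxa)
    (by simp [ENNReal.ofReal_of_nonpos, hb.bl_nonpos])
  have h3 : Integrable (fun z => bl (M.T n x a z)) Q.measure := by simpa using h2.1.neg
  refine ⟨h1.1.sub h3, ?_⟩
  rw [integral_sub h1.1 h3]
  have e1 := (integral_mono h1.1 h1.1.abs fun z => le_abs_self _).trans h1.2
  have e2 := (integral_mono h2.1 h2.1.abs fun z => le_abs_self _).trans h2.2
  rw [integral_neg] at e2
  linarith

theorem integrable_comp_T {n : ℕ} (hn : n < M.N) {x : ℝ} {a : A} (hxa : (x, a) ∈ M.D n)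
    (Q : M.Amb (n + 1)) {v : ℝ → ℝ} (hv : Measurable v) {lam : ℝ}
    (hle : ∀ y, |v y| ≤ lam * (bu y - bl y)) : Integrable (fun z => v (M.T n x a z)) Q.measure :=
  ((hb.bound_bound hn hxa Q).1.const_mul lam).mono'
    (hv.comp (M.measurable_T_right n x a)).aestronglyMeasurable (.of_forall fun _ => hle _)

theorem integrable_integrand {n : ℕ} (hn : n < M.N) {x : ℝ} {a : A} (hxa : (x, a) ∈ M.D n)
    (Q : M.Amb (n + 1)) {v : ℝ → ℝ} (hv : Measurable v) {lam : ℝ}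
    (hle : ∀ y, |v y| ≤ lam * (bu y - bl y)) :
    Integrable (fun z => M.c n x a (M.T n x a z) + v (M.T n x a z)) Q.measure :=
  (hb.cost_bound hn hxa Q).1.add (hb.integrable_comp_T hn hxa Q hv hle)

/-- The cost contributes `b(x)` and the continuation at most `lam · α · b(x)`. The same factor
drives the recursion of `valueBound`. -/
theorem abs_L_le {n : ℕ} (hn : n < M.N) {x : ℝ} {a : A} (hxa : (x, a) ∈ M.D n)
    (Q : M.Amb (n + 1)) {v : ℝ → ℝ} (hv : Measurable v) {lam : ℝ} (hlam : 0 ≤ lam)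
    (hle : ∀ y, |v y| ≤ lam * (bu y - bl y)) :
    |M.L n v x a Q| ≤ (1 + lam * α) * (bu x - bl x) := by
  have hc := hb.cost_bound hn hxa Q
  have hbb := hb.bound_bound hn hxa Q
  have hvi := hb.integrable_comp_T hn hxa Q hv hle
  rw [L, integral_add hc.1 hvi]
  have h1 := abs_integral_le_integral_abs (f := fun z => M.c n x a (M.T n x a z)) (μ := Q.measure)
  have h2 := abs_integral_le_integral_abs (f := fun z => v (M.T n x a z)) (μ := Q.measure)
  have h3 := integral_mono hvi.abs (hbb.1.const_mul lam) fun z => hle _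
  rw [integral_const_mul] at h3
  have h4 := mul_le_mul_of_nonneg_left hbb.2 hlam
  have := abs_add_le (∫ z, M.c n x a (M.T n x a z) ∂Q.measure) (∫ z, v (M.T n x a z) ∂Q.measure)
  linarith [hc.2]

theorem bddAbove_L {n : ℕ} (hn : n < M.N) {x : ℝ} {a : A} (hxa : (x, a) ∈ M.D n)
    {v : ℝ → ℝ} (hv : Measurable v) {lam : ℝ} (hlam : 0 ≤ lam)
    (hle : ∀ y, |v y| ≤ lam * (bu y - bl y)) :
    BddAbove (Set.range fun Q : M.Amb (n + 1) => M.L n v x a Q) := by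
  refine ⟨(1 + lam * α) * (bu x - bl x), ?_⟩
  rintro _ ⟨Q, rfl⟩
  exact (le_abs_self _).trans (hb.abs_L_le hn hxa Q hv hlam hle)

theorem abs_iSup_L_le {n : ℕ} (hn : n < M.N) {x : ℝ} {a : A} (hxa : (x, a) ∈ M.D n)
    {v : ℝ → ℝ} (hv : Measurable v) {lam : ℝ} (hlam : 0 ≤ lam)
    (hle : ∀ y, |v y| ≤ lam * (bu y - bl y)) :
    |⨆ Q : M.Amb (n + 1), M.L n v x a Q| ≤ (1 + lam * α) * (bu x - bl x) := by
  rw [abs_le]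
  have Q₀ : M.Amb (n + 1) := Classical.arbitrary _
  exact ⟨(abs_le.1 (hb.abs_L_le hn hxa Q₀ hv hlam hle)).1.trans
    (le_ciSup (hb.bddAbove_L hn hxa hv hlam hle) Q₀),
    ciSup_le fun Q => (abs_le.1 (hb.abs_L_le hn hxa Q hv hlam hle)).2⟩

end Bounding

theorem monotone_L (hb : M.Bounding α εl εu bl bu) (hmono : M.MonotoneData) {n : ℕ}
    (hn : n < M.N) {v : ℝ → ℝ} (hv : v ∈ potentialValueFunctions fun x => bu x - bl x)
    {x x' : ℝ} (hx : x ≤ x') {a : A} (ha : (x', a) ∈ M.D n) (Q : M.Amb (n + 1)) :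
    M.L n v x a Q ≤ M.L n v x' a Q := by
  obtain ⟨hvm, ⟨lam, hlam, hle⟩, hlsc, hmon⟩ := hv
  have ha' : (x, a) ∈ M.D n := hmono.antitone_D n hn x x' hx ha
  refine integral_mono (hb.integrable_integrand hn ha' Q hvm hle)
    (hb.integrable_integrand hn ha Q hvm hle) fun z => ?_
  have hT : M.T n x a z ≤ M.T n x' a z := hmono.monotone_T n hn a z ha' ha hx
  have hm := hmono.monotone_c n hn a
  exact add_le_add (@hm (x, M.T n x a z) ha' (x', M.T n x' a z) ha ⟨hx, hT⟩) (hmon hT)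

section Topological

variable [TopologicalSpace A]

theorem LocallyDominated.memLp (hdom : M.LocallyDominated bl bu) {n : ℕ} (hn : n < M.N)
    {w₀ : ℝ × A} (hw₀ : w₀ ∈ M.D n) {v : ℝ → ℝ} {lam : ℝ} (hlam : 0 ≤ lam)
    (hle : ∀ y, |v y| ≤ lam * (bu y - bl y)) :
    ∃ g : Z → ℝ, Measurable g ∧ MemLp g M.p (M.P (n + 1)) ∧ ∀ᶠ w in 𝓝[M.D n] w₀, ∀ z,
      |M.c n w.1 w.2 (M.T n w.1 w.2 z) + v (M.T n w.1 w.2 z)| ≤ g z := by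
  obtain ⟨Θ₁, Θ₂, h1, h2, -, -, h3, h4, h5⟩ := hdom n hn w₀ hw₀
  refine ⟨fun z => Θ₁ z + lam * Θ₂ z, h1.add (h2.const_mul lam), h3.add (h4.const_mul lam), ?_⟩
  filter_upwards [h5] with w hw z
  refine (abs_add_le _ _).trans (add_le_add (hw z).1 ((hle _).trans ?_))
  exact mul_le_mul_of_nonneg_left (hw z).2 hlam

/-- The local dominating function also dominates at `(x, a)` itself. The integrand is thus in `L^p`,
and integrals of `L^p` functions are weak* continuous in `Q`. -/
theorem LocallyDominated.continuous_L (hdom : M.LocallyDominated bl bu) {n : ℕ} (hn : n < M.N)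
    {x : ℝ} {a : A} (hxa : (x, a) ∈ M.D n) {v : ℝ → ℝ} (hv : Measurable v) {lam : ℝ}
    (hlam : 0 ≤ lam) (hle : ∀ y, |v y| ≤ lam * (bu y - bl y)) :
    Continuous fun Q : M.Amb (n + 1) => M.L n v x a Q := by
  obtain ⟨g, -, hg, hle⟩ := hdom.memLp hn hxa hlam hle
  refine Amb.continuous_integral (hg.mono' ?_ (.of_forall (hle.self_of_nhdsWithin hxa)))
  exact ((M.measurable_cost n x a).add
    (hv.comp (M.measurable_T_right n x a))).aestronglyMeasurable

theorem tendsto_min_of_lowerSemicontinuousWithinAt {W : Type*} [TopologicalSpace W] {s : Set W}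
    {f : W → ℝ} {w : W} (hf : LowerSemicontinuousWithinAt f s w) :
    Tendsto (fun w' => min (f w') (f w)) (𝓝[s] w) (𝓝 (f w)) := by
  refine tendsto_order.2 ⟨fun y hy => ?_, fun y hy => .of_forall fun w' => (min_le_right _ _).trans_lt hy⟩
  filter_upwards [hf y hy] with w' hw'
  exact lt_min hw' hy

/-- Composing with a merely lower semicontinuous `T` is possible because `c` and `v` increase in the
next state: lowering `T(w')` to `min (T(w')) (T(w))`, which does converge to `T(w)`, can only
decrease them. -/
theorem lowerSemicontinuousOn_integrand (hsemi : M.Semicontinuous) (hmono : M.MonotoneData)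
    {n : ℕ} (hn : n < M.N) {v : ℝ → ℝ} (hv : LowerSemicontinuous v) (hvm : Monotone v) (z : Z) :
    LowerSemicontinuousOn
      (fun w : ℝ × A => M.c n w.1 w.2 (M.T n w.1 w.2 z) + v (M.T n w.1 w.2 z)) (M.D n) := by
  refine LowerSemicontinuousOn.add (fun w hw y hy => ?_) fun w hw y hy => ?_
  · have ht := tendsto_min_of_lowerSemicontinuousWithinAt (hsemi.lsc_T n hn z w hw)
    have hc := hsemi.lsc_c n hn (w, M.T n w.1 w.2 z) ⟨hw, trivial⟩ y hy
    have ht' : Tendsto (fun w' : ℝ × A => (w', min (M.T n w'.1 w'.2 z) (M.T n w.1 w.2 z)))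
        (𝓝[M.D n] w) (𝓝[M.D n ×ˢ Set.univ] (w, M.T n w.1 w.2 z)) :=
      tendsto_nhdsWithin_iff.2 ⟨(tendsto_nhdsWithin_of_tendsto_nhds tendsto_id).prodMk_nhds ht,
        eventually_mem_nhdsWithin.mono fun _ h => ⟨h, trivial⟩⟩
    filter_upwards [ht'.eventually hc, eventually_mem_nhdsWithin] with w' h1 h2
    have hm := hmono.monotone_c n hn w'.2
    exact lt_of_lt_of_le h1 (@hm (w'.1, min (M.T n w'.1 w'.2 z) (M.T n w.1 w.2 z)) h2
      (w'.1, M.T n w'.1 w'.2 z) h2 ⟨le_rfl, min_le_left _ _⟩)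
  · have ht := tendsto_min_of_lowerSemicontinuousWithinAt (hsemi.lsc_T n hn z w hw)
    filter_upwards [ht.eventually (hv _ y hy)] with w' h
    exact lt_of_lt_of_le h (hvm (min_le_left _ _))

theorem lowerSemicontinuousOn_iSup_L [FirstCountableTopology A]
    (hb : M.Bounding α εl εu bl bu) (hdom : M.LocallyDominated bl bu)
    (hsemi : M.Semicontinuous) (hmono : M.MonotoneData) {n : ℕ} (hn : n < M.N) {v : ℝ → ℝ}
    (hv : v ∈ potentialValueFunctions fun x => bu x - bl x) :
    LowerSemicontinuousOn (fun w : ℝ × A => ⨆ Q : M.Amb (n + 1), M.L n v w.1 w.2 Q) (M.D n) := by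
  obtain ⟨hvm, ⟨lam, hlam, hle⟩, hlsc, hmon⟩ := hv
  refine lowerSemicontinuousOn_ciSup (fun w hw => hb.bddAbove_L hn hw hvm hlam hle) fun Q => ?_
  refine lowerSemicontinuousOn_integral (f := fun w z =>
      M.c n w.1 w.2 (M.T n w.1 w.2 z) + v (M.T n w.1 w.2 z))
    (fun w hw => hb.integrable_integrand hn hw Q hvm hle)
    (fun w => (M.measurable_cost n w.1 w.2).add (hvm.comp (M.measurable_T_right n w.1 w.2)))
    (lowerSemicontinuousOn_integrand hsemi hmono hn hlsc hmon) fun w hw => ?_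
  obtain ⟨g, hg, hgp, h⟩ := hdom.memLp hn hw hlam hle
  exact ⟨g, hg, Q.integrable hgp, h⟩

variable [TopologicalSpace.MetrizableSpace A] [SecondCountableTopology A] [BorelSpace A]

/-- Existence of a measurable minimizer in the Bellman operator. -/
theorem exists_minimizer
    (hb : M.Bounding α εl εu bl bu) (hdom : M.LocallyDominated bl bu)
    (hsemi : M.Semicontinuous) (hmono : M.MonotoneData) {n : ℕ} (hn : n < M.N) {v : ℝ → ℝ}
    (hv : v ∈ potentialValueFunctions fun x => bu x - bl x) :
    ∃ d : ℝ → A, Measurable d ∧ (∀ x, (x, d x) ∈ M.D n) ∧ (∀ x, M.opRule n d v x = M.op n v x) ∧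
      ∀ x a, (x, a) ∈ M.D n → M.op n v x ≤ ⨆ Q : M.Amb (n + 1), M.L n v x a Q := by
  obtain ⟨d, hd, hmin⟩ := exists_measurable_argmin (hsemi.upperSemicontinuous_D n hn)
    (hsemi.isCompact_D n hn) (M.exists_action n)
    (lowerSemicontinuousOn_iSup_L hb hdom hsemi hmono hn hv)
  have hop : ∀ x, M.opRule n d v x = M.op n v x := by
    intro x
    have : Nonempty {a : A // (x, a) ∈ M.D n} := ⟨⟨d x, (hmin x).1⟩⟩
    refine le_antisymm (le_ciInf fun a => (hmin x).2 a.1 a.2) ?_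
    refine ciInf_le (f := fun a : {a : A // (x, a) ∈ M.D n} => ⨆ Q : M.Amb (n + 1), M.L n v x a Q)
      ⟨M.opRule n d v x, ?_⟩ ⟨d x, (hmin x).1⟩
    rintro _ ⟨a, rfl⟩
    exact (hmin x).2 a.1 a.2
  exact ⟨d, hd, fun x => (hmin x).1, hop, fun x a ha => hop x ▸ (hmin x).2 a ha⟩

theorem op_mem_potentialValueFunctions
    (hb : M.Bounding α εl εu bl bu) (hdom : M.LocallyDominated bl bu)
    (hsemi : M.Semicontinuous) (hmono : M.MonotoneData) {n : ℕ} (hn : n < M.N) {v : ℝ → ℝ}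
    (hv : v ∈ potentialValueFunctions fun x => bu x - bl x) :
    M.op n v ∈ potentialValueFunctions fun x => bu x - bl x := by
  obtain ⟨d, -, hD, hop, hle⟩ := exists_minimizer hb hdom hsemi hmono hn hv
  have hlsc : LowerSemicontinuous (M.op n v) := by
    refine lowerSemicontinuous_iff_isClosed_preimage.2 fun r => ?_
    -- The infimum is attained, so its sublevel sets are projections of sublevel sets of the
    -- function being minimized.
    convert isClosed_setOf_exists_le (hsemi.upperSemicontinuous_D n hn)
      (lowerSemicontinuousOn_iSup_L hb hdom hsemi hmono hn hv) isClosed_univ r using 1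
    ext x
    constructor
    · intro hx
      refine ⟨d x, hD x, trivial, ?_⟩
      change M.opRule n d v x ≤ r
      rw [hop]
      exact hx
    · rintro ⟨a, ha, -, h⟩
      exact (hle x a ha).trans h
  have hv' := hv
  obtain ⟨hvm, ⟨lam, hlam, hvle⟩, -, -⟩ := hv'
  refine ⟨hlsc.measurable, ⟨1 + lam * α, by have := hb.α_nonneg; positivity, fun x => ?_⟩, hlsc,
    fun x x' hx => ?_⟩
  · rw [← hop]
    exact hb.abs_iSup_L_le hn (hD x) hvm hlam hvle
  -- A minimizer at the larger state is admissible at the smaller one and costs no more there.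
  · refine (hle x (d x') (hmono.antitone_D n hn x x' hx (hD x'))).trans ?_
    rw [← hop x']
    exact ciSup_mono (hb.bddAbove_L hn (hD x') hvm hlam hvle)
      fun Q => monotone_L hb hmono hn hv hx (hD x') Q

omit [TopologicalSpace.MetrizableSpace A] [SecondCountableTopology A] [BorelSpace A]

open Classical in
theorem exists_almost_maximizer
    (hb : M.Bounding α εl εu bl bu) (hdom : M.LocallyDominated bl bu) {n : ℕ} (hn : n < M.N)
    {v : ℝ → ℝ} (hv : v ∈ potentialValueFunctions fun x => bu x - bl x) {ε : ℝ} (hε : 0 < ε) :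
    ∃ γ : ℝ × A → M.Amb (n + 1), Measurable γ ∧ ∀ x a, (x, a) ∈ M.D n →
      ⨆ Q : M.Amb (n + 1), M.L n v x a Q ≤ M.L n v x a (γ (x, a)) + ε := by
  have := (hb.normBounded hn).secondCountableTopology
  obtain ⟨hvm, ⟨lam, hlam, hle⟩, -, -⟩ := hv
  -- Nothing is known about `L` off `D n`; the value 0 there keeps the objective continuous and
  -- bounded in `Q`.
  have hc : ∀ w : ℝ × A, Continuous fun Q : M.Amb (n + 1) =>
      if w ∈ M.D n then M.L n v w.1 w.2 Q else 0 := by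
    intro w
    by_cases hw : w ∈ M.D n
    · simpa [hw] using hdom.continuous_L hn hw hvm hlam hle
    · simpa [hw] using continuous_const
  have hbd : ∀ w : ℝ × A, BddAbove (Set.range fun Q : M.Amb (n + 1) =>
      if w ∈ M.D n then M.L n v w.1 w.2 Q else 0) := by
    intro w
    by_cases hw : w ∈ M.D n
    · simpa [hw] using hb.bddAbove_L hn hw hvm hlam hle
    · simp [hw]
  obtain ⟨γ, hγ, h⟩ := exists_measurable_almost_argmax _ hc
    (fun Q => (M.measurable_L n hvm Q).ite (M.measurableSet_D n) measurable_const) hbd hε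
  exact ⟨γ, hγ, fun x a hxa => ciSup_le fun Q => by simpa [hxa] using h (x, a) Q⟩

open Classical in
theorem exists_maximizer
    (hb : M.Bounding α εl εu bl bu) (hdom : M.LocallyDominated bl bu) (hcl : M.WeakStarClosed)
    {n : ℕ} (hn : n < M.N) {v : ℝ → ℝ} (hv : v ∈ potentialValueFunctions fun x => bu x - bl x) :
    ∃ γ : ℝ × A → M.Amb (n + 1), Measurable γ ∧ ∀ x a, (x, a) ∈ M.D n → ∀ Q : M.Amb (n + 1),
      M.L n v x a Q ≤ M.L n v x a (γ (x, a)) := by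
  have := (hb.normBounded hn).secondCountableTopology
  have := (hb.normBounded hn).metrizableSpace
  have := (hb.normBounded hn).compactSpace (hcl (n + 1) (by lia) hn)
  obtain ⟨hvm, ⟨lam, hlam, hle⟩, -, -⟩ := hv
  have hc : ∀ w : ℝ × A, Continuous fun Q : M.Amb (n + 1) =>
      if w ∈ M.D n then M.L n v w.1 w.2 Q else 0 := by
    intro w
    by_cases hw : w ∈ M.D n
    · simpa [hw] using hdom.continuous_L hn hw hvm hlam hle
    · simpa [hw] using continuous_const
  obtain ⟨γ, hγ, h⟩ := exists_measurable_argmax _ hc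
    (fun Q => (M.measurable_L n hvm Q).ite (M.measurableSet_D n) measurable_const)
  exact ⟨γ, hγ, fun x a hxa Q => by simpa [hxa] using h (x, a) Q⟩

end Topological

end RobustMDP

theorem integrable_integral_of_compProd {α β : Type*} [MeasurableSpace α] [MeasurableSpace β]
    {μ : Measure α} [SFinite μ] {κ : Kernel α β} [IsSFiniteKernel κ] {f : α × β → ℝ}
    (hf : Integrable f (μ ⊗ₘ κ)) : Integrable (fun a => ∫ b, f (a, b) ∂(κ a)) μ := by
  rw [Measure.compProd] at hf
  simpa using hf.integral_compProd

/-! ### Histories -/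

namespace Hist

variable {A : Type*} {n : ℕ}

@[simp] theorem last_snoc (h : Hist A n) (a : A) (x : ℝ) : (h.snoc a x).last = x := by
  simp [last, snoc]

theorem measurable_snoc [MeasurableSpace A] :
    Measurable fun w : Hist A n × (A × ℝ) => w.1.snoc w.2.1 w.2.2 := by
  refine Measurable.prodMk (measurable_pi_lambda _ fun i => ?_) (measurable_pi_lambda _ fun i => ?_)
  · refine Fin.lastCases ?_ (fun j => ?_) i
    · simp only [Fin.snoc_last]
      fun_prop
    · simp only [Fin.snoc_castSucc]
      exact (measurable_pi_apply j).comp (measurable_fst.comp measurable_fst)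
  · refine Fin.lastCases ?_ (fun j => ?_) i
    · simp only [Fin.snoc_last]
      fun_prop
    · simp only [Fin.snoc_castSucc]
      exact (measurable_pi_apply j).comp (measurable_snd.comp measurable_fst)

end Hist

namespace RobustMDP

variable {A : Type*} {Z : Type*} [MeasurableSpace A] [MeasurableSpace Z] {M : RobustMDP A Z}
  {α εl εu : ℝ} {bl bu : ℝ → ℝ}

theorem feasible_snoc {n : ℕ} {h : Hist A n} {a : A} {x : ℝ} :
    M.Feasible (h.snoc a x) ↔ M.Feasible h ∧ (h.last, a) ∈ M.D n := by
  simp only [Feasible, Fin.forall_fin_succ', Hist.snoc, Hist.last]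
  simp

theorem measurableSet_feasible (M : RobustMDP A Z) (n : ℕ) :
    MeasurableSet {h : Hist A n | M.Feasible h} := by
  have : {h : Hist A n | M.Feasible h} =
      ⋂ k : Fin n, (fun h : Hist A n => (h.1 k.castSucc, h.2 k)) ⁻¹' M.D k := by
    ext h; simp [Feasible]
  rw [this]
  refine MeasurableSet.iInter fun k => (M.measurableSet_D k).preimage ?_
  exact ((measurable_pi_apply _).comp measurable_fst).prodMk
    ((measurable_pi_apply _).comp measurable_snd)

/-- The cost `c_{n}(xₙ, aₙ, xₙ₊₁)` of the last transition of a history up to time `n + 1`. -/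
def lastCost (M : RobustMDP A Z) (n : ℕ) (h : Hist A (n + 1)) : ℝ :=
  M.c n (h.1 (Fin.last n).castSucc) (h.2 (Fin.last n)) h.last

@[simp] theorem lastCost_snoc {n : ℕ} (h : Hist A n) (a : A) (x : ℝ) :
    M.lastCost n (h.snoc a x) = M.c n h.last a x := by
  simp [lastCost, Hist.snoc, Hist.last]

theorem measurable_lastCost (M : RobustMDP A Z) (n : ℕ) : Measurable (M.lastCost n) :=
  (M.measurable_c n).comp ((((measurable_pi_apply _).comp measurable_fst).prodMk
    ((measurable_pi_apply _).comp measurable_snd)).prodMk Hist.measurable_last)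

/-- The cost accumulated between the times `n` and `k`. -/
def partialCost (M : RobustMDP A Z) (n k : ℕ) (h : Hist A k) : ℝ :=
  ∑ j ∈ Finset.univ.filter (fun j : Fin k => n ≤ j), M.c j (h.1 j.castSucc) (h.2 j) (h.1 j.succ)

theorem measurable_partialCost (M : RobustMDP A Z) (n k : ℕ) : Measurable (M.partialCost n k) :=
  Finset.measurable_fun_sum _ fun j _ => (M.measurable_c j).comp
    (f := fun h : Hist A k => ((h.1 j.castSucc, h.2 j), h.1 j.succ))
    ((((measurable_pi_apply _).comp measurable_fst).prodMk
      ((measurable_pi_apply _).comp measurable_snd)).prodMk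
        ((measurable_pi_apply _).comp measurable_fst))

theorem partialCost_self (n : ℕ) (h : Hist A n) : M.partialCost n n h = 0 := by
  rw [partialCost, Finset.filter_false_of_mem fun j _ => by have := j.2; lia, Finset.sum_empty]

theorem partialCost_snoc {n k : ℕ} (hnk : n ≤ k) (h : Hist A k) (a : A) (x : ℝ) :
    M.partialCost n (k + 1) (h.snoc a x) = M.partialCost n k h + M.c k h.last a x := by
  simp only [partialCost, Finset.sum_filter, Fin.sum_univ_castSucc, Hist.snoc, Hist.last,
    Fin.succ_castSucc, Fin.snoc_castSucc, Fin.val_castSucc, Fin.val_last, hnk, if_true,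
    Fin.snoc_last, Fin.succ_last]

/-! ### One transition -/

section Step

variable (π : M.RandPolicy) (γ : M.NaturePolicy)

instance (k : ℕ) : IsMarkovKernel (M.transKernel γ k) := by
  refine Kernel.IsMarkovKernel.map _ ?_
  exact (M.measurable_T k).comp
    (((Hist.measurable_last.comp (measurable_fst.comp measurable_fst)).prodMk
      (measurable_snd.comp measurable_fst)).prodMk measurable_snd)

instance (k : ℕ) : IsMarkovKernel (M.stepKernel π γ k) :=
  Kernel.IsMarkovKernel.map _ Hist.measurable_snoc

theorem measurable_snoc_T (M : RobustMDP A Z) {k : ℕ} (h : Hist A k) :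
    Measurable fun w : A × Z => h.snoc w.1 (M.T k h.last w.1 w.2) :=
  Hist.measurable_snoc.comp (measurable_const.prodMk (measurable_fst.prodMk
    ((M.measurable_T k).comp ((measurable_const.prodMk measurable_fst).prodMk measurable_snd))))

/-- The assumptions bound integrals over the disturbance, so a transition is rewritten as drawing an
action and a disturbance. -/
theorem stepKernel_apply {k : ℕ} (h : Hist A k) :
    M.stepKernel π γ k h =
      ((π.kernel k h) ⊗ₘ ((γ.kernel k).comap (Prod.mk h) measurable_prodMk_left)).map
        (fun w : A × Z => h.snoc w.1 (M.T k h.last w.1 w.2)) := by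
  have hT : Measurable fun w : (Hist A k × A) × Z => M.T k w.1.1.last w.1.2 w.2 :=
    (M.measurable_T k).comp
      (((Hist.measurable_last.comp (measurable_fst.comp measurable_fst)).prodMk
        (measurable_snd.comp measurable_fst)).prodMk measurable_snd)
  refine Measure.ext_of_lintegral _ fun f hf => ?_
  rw [stepKernel, Kernel.lintegral_map _ Hist.measurable_snoc _ hf,
    Kernel.lintegral_id_prod (f := fun w : Hist A k × (A × ℝ) => f (w.1.snoc w.2.1 w.2.2))
      (hf.comp Hist.measurable_snoc), Kernel.lintegral_compProd _ _ _
      (f := fun w : A × ℝ => f (h.snoc w.1 w.2))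
      ((hf.comp Hist.measurable_snoc).comp measurable_prodMk_left),
    lintegral_map hf (M.measurable_snoc_T h),
    Measure.lintegral_compProd (f := fun w : A × Z => f (h.snoc w.1 (M.T k h.last w.1 w.2)))
      (hf.comp (M.measurable_snoc_T h))]
  refine lintegral_congr fun a => ?_
  have hf' : Measurable fun x : ℝ => f (h.snoc a x) :=
    (hf.comp Hist.measurable_snoc).comp
      (measurable_prodMk_left.comp (measurable_prodMk_left (x := a)))
  rw [transKernel, Kernel.lintegral_map _ hT _ hf']
  exact Kernel.lintegral_id_prod (hf'.comp hT) _ _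

theorem ae_mem_D {k : ℕ} {h : Hist A k} (hh : M.Feasible h) :
    ∀ᵐ a ∂(π.kernel k h), (h.last, a) ∈ M.D k :=
  (mem_ae_iff_prob_eq_one (measurable_prodMk_left (M.measurableSet_D k))).2 (π.admissible k h hh)

/-- Integration with respect to one transition, given a bound for all admissible actions and all
measures in the ambiguity set. -/
theorem integrable_step {k : ℕ} {h : Hist A k} (hh : M.Feasible h) {F : Hist A (k + 1) → ℝ}
    (hF : Measurable F) {B : ℝ} (hB : ∀ a, (h.last, a) ∈ M.D k → ∀ Q : M.Amb (k + 1),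
      Integrable (fun z => F (h.snoc a (M.T k h.last a z))) Q.measure ∧
        ∫ z, |F (h.snoc a (M.T k h.last a z))| ∂Q.measure ≤ B) :
    Integrable F (M.stepKernel π γ k h) ∧
    ∫ h', |F h'| ∂(M.stepKernel π γ k h) ≤ B ∧
    Integrable (fun a => ∫ z, F (h.snoc a (M.T k h.last a z)) ∂(γ.rule k (h, a)).measure)
      (π.kernel k h) ∧
    ∫ h', F h' ∂(M.stepKernel π γ k h) =
      ∫ a, ∫ z, F (h.snoc a (M.T k h.last a z)) ∂(γ.rule k (h, a)).measure ∂(π.kernel k h) := by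
  set κ := (γ.kernel k).comap (Prod.mk h) measurable_prodMk_left
  have hm := M.measurable_snoc_T h
  -- Stated for a general `G` because both `F` and `|F|` are needed.
  have hint : ∀ G : Hist A (k + 1) → ℝ, Measurable G → (∀ a, (h.last, a) ∈ M.D k →
      ∀ Q : M.Amb (k + 1), Integrable (fun z => G (h.snoc a (M.T k h.last a z))) Q.measure ∧
        ∫ z, |G (h.snoc a (M.T k h.last a z))| ∂Q.measure ≤ B) →
      Integrable (fun w : A × Z => G (h.snoc w.1 (M.T k h.last w.1 w.2))) (π.kernel k h ⊗ₘ κ) := by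
    intro G hG hB
    have hGm : Measurable fun w : A × Z => G (h.snoc w.1 (M.T k h.last w.1 w.2)) := hG.comp hm
    refine (Measure.integrable_compProd_iff hGm.aestronglyMeasurable).2 ⟨?_, ?_⟩
    · filter_upwards [ae_mem_D π hh] with a ha
      exact (hB a ha _).1
    · refine Integrable.of_bound (C := B)
        (hGm.norm.stronglyMeasurable.integral_kernel_prod_right' (κ := κ)).aestronglyMeasurable ?_
      filter_upwards [ae_mem_D π hh] with a ha
      rw [Real.norm_of_nonneg (integral_nonneg fun z => norm_nonneg _)]
      exact (hB a ha _).2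
  have hi := hint F hF hB
  have hB' : ∀ a, (h.last, a) ∈ M.D k → ∀ Q : M.Amb (k + 1),
      Integrable (fun z => |F (h.snoc a (M.T k h.last a z))|) Q.measure ∧
        ∫ z, |(|F (h.snoc a (M.T k h.last a z))|)| ∂Q.measure ≤ B := fun a ha Q =>
    ⟨(hB a ha Q).1.abs, by simpa using (hB a ha Q).2⟩
  have hi' := hint (fun h' => |F h'|) hF.abs hB'
  refine ⟨?_, ?_, integrable_integral_of_compProd hi, ?_⟩
  · rw [stepKernel_apply]
    exact (integrable_map_measure hF.aestronglyMeasurable hm.aemeasurable).2 hi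
  · rw [stepKernel_apply, integral_map hm.aemeasurable hF.abs.aestronglyMeasurable,
      Measure.integral_compProd hi']
    refine (integral_mono_ae (integrable_integral_of_compProd hi') (integrable_const B) ?_).trans (by simp)
    filter_upwards [ae_mem_D π hh] with a ha
    exact (hB a ha _).2
  · rw [stepKernel_apply, integral_map hm.aemeasurable hF.aestronglyMeasurable,
      Measure.integral_compProd hi]
    rfl

theorem ae_feasible_step {k : ℕ} {h : Hist A k} (hh : M.Feasible h) :
    ∀ᵐ h' ∂(M.stepKernel π γ k h), M.Feasible h' := by
  have hm := M.measurable_snoc_T h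
  rw [stepKernel_apply, ae_map_iff hm.aemeasurable (M.measurableSet_feasible _)]
  refine Measure.ae_compProd_of_ae_ae ((M.measurableSet_feasible _).preimage hm) ?_
  filter_upwards [ae_mem_D π hh] with a ha
  exact .of_forall fun z => feasible_snoc.2 ⟨hh, ha⟩

end Step

end RobustMDP

namespace RobustMDP

variable {A : Type*} {Z : Type*} [MeasurableSpace A] [MeasurableSpace Z] {M : RobustMDP A Z}
  {α εl εu : ℝ} {bl bu : ℝ → ℝ}

/-! ### Values of policies by backward recursion -/

/-- The expected cost of the last `m` stages, the first of them being stage `k`, computed by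
backward recursion. -/
noncomputable def backwardValue (π : M.RandPolicy) (γ : M.NaturePolicy) : ℕ → (k : ℕ) → Hist A k → ℝ
  | 0, _, h => M.cN h.last
  | m + 1, k, h => ∫ h', (M.lastCost k h' + backwardValue π γ m (k + 1) h') ∂(M.stepKernel π γ k h)

/-- The constant in the bound of the expected cost of `m` stages. -/
noncomputable def valueBound (α : ℝ) : ℕ → ℝ
  | 0 => 1
  | m + 1 => 1 + valueBound α m * α

theorem valueBound_nonneg (hα : 0 ≤ α) (m : ℕ) : 0 ≤ valueBound α m := by
  induction m with
  | zero => exact zero_le_one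
  | succ m ih => rw [valueBound]; positivity

section Values

variable (π : M.RandPolicy) (γ : M.NaturePolicy)

theorem measurable_backwardValue (m k : ℕ) : Measurable (backwardValue π γ m k) := by
  induction m generalizing k with
  | zero => exact M.measurable_cN.comp Hist.measurable_last
  | succ m ih =>
    exact (((M.measurable_lastCost k).add (ih (k + 1))).stronglyMeasurable.integral_kernel
      (κ := M.stepKernel π γ k)).measurable

variable {π γ}

theorem Bounding.step_aux (hb : M.Bounding α εl εu bl bu) {k : ℕ} (hk : k < M.N) {h : Hist A k}
    (hh : M.Feasible h) {G : Hist A (k + 1) → ℝ} (hG : Measurable G) {lam : ℝ} (hlam : 0 ≤ lam)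
    (hle : ∀ h', M.Feasible h' → |G h'| ≤ lam * (bu h'.last - bl h'.last))
    (a : A) (ha : (h.last, a) ∈ M.D k) (Q : M.Amb (k + 1)) :
    Integrable (fun z => M.lastCost k (h.snoc a (M.T k h.last a z)) +
      G (h.snoc a (M.T k h.last a z))) Q.measure ∧
    ∫ z, |M.lastCost k (h.snoc a (M.T k h.last a z)) + G (h.snoc a (M.T k h.last a z))|
      ∂Q.measure ≤ (1 + lam * α) * (bu h.last - bl h.last) := by
  have hc := hb.cost_bound hk ha Q
  have hbb := hb.bound_bound hk ha Q
  have hGle : ∀ z, |G (h.snoc a (M.T k h.last a z))| ≤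
      lam * (bu (M.T k h.last a z) - bl (M.T k h.last a z)) := fun z => by
    simpa using hle _ (feasible_snoc (x := M.T k h.last a z) |>.2 ⟨hh, ha⟩)
  have hGi : Integrable (fun z => G (h.snoc a (M.T k h.last a z))) Q.measure :=
    (hbb.1.const_mul lam).mono' ((hG.comp (M.measurable_snoc_T h)).comp
      (measurable_prodMk_left (x := a))).aestronglyMeasurable (.of_forall hGle)
  simp only [lastCost_snoc]
  refine ⟨hc.1.add hGi, ?_⟩
  have h1 := integral_mono (hc.1.add hGi).abs (hc.1.abs.add hGi.abs) fun z => abs_add_le _ _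
  have h2 := integral_mono hGi.abs (hbb.1.const_mul lam) hGle
  rw [integral_const_mul] at h2
  have e : ∫ z, ((fun z => |M.c k h.last a (M.T k h.last a z)|) +
      fun z => |G (h.snoc a (M.T k h.last a z))|) z ∂Q.measure =
      (∫ z, |M.c k h.last a (M.T k h.last a z)| ∂Q.measure) +
        ∫ z, |G (h.snoc a (M.T k h.last a z))| ∂Q.measure := integral_add hc.1.abs hGi.abs
  have h3 := mul_le_mul_of_nonneg_left hbb.2 hlam
  refine h1.trans ?_
  rw [e]
  linarith [hc.2]

theorem Bounding.abs_backwardValue_le (hb : M.Bounding α εl εu bl bu) {m k : ℕ}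
    (hkm : k + m = M.N) (h : Hist A k) (hh : M.Feasible h) :
    |backwardValue π γ m k h| ≤ valueBound α m * (bu h.last - bl h.last) := by
  induction m generalizing k with
  | zero => simpa [backwardValue, valueBound] using hb.abs_cN_le h.last
  | succ m ih =>
    have := integrable_step π γ hh ((M.measurable_lastCost k).add
      (measurable_backwardValue π γ m (k + 1)))
      (hb.step_aux (by lia) hh (measurable_backwardValue π γ m (k + 1))
        (valueBound_nonneg hb.α_nonneg m) (fun h' hh' => ih (by lia) h' hh'))
    exact (abs_integral_le_integral_abs).trans this.2.1

theorem Bounding.backwardValue_step (hb : M.Bounding α εl εu bl bu) {m k : ℕ}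
    (hkm : k + (m + 1) = M.N) (h : Hist A k) (hh : M.Feasible h) :
    (∀ a, (h.last, a) ∈ M.D k → ∀ Q : M.Amb (k + 1), Integrable (fun z =>
      M.c k h.last a (M.T k h.last a z) + backwardValue π γ m (k + 1)
        (h.snoc a (M.T k h.last a z))) Q.measure) ∧
    Integrable (fun h' => M.lastCost k h' + backwardValue π γ m (k + 1) h')
      (M.stepKernel π γ k h) ∧
    Integrable (fun a => ∫ z, (M.c k h.last a (M.T k h.last a z) +
      backwardValue π γ m (k + 1) (h.snoc a (M.T k h.last a z))) ∂(γ.rule k (h, a)).measure)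
      (π.kernel k h) ∧
    backwardValue π γ (m + 1) k h = ∫ a, ∫ z, (M.c k h.last a (M.T k h.last a z) +
      backwardValue π γ m (k + 1) (h.snoc a (M.T k h.last a z))) ∂(γ.rule k (h, a)).measure
        ∂(π.kernel k h) := by
  have h0 := hb.step_aux (by lia) hh (measurable_backwardValue π γ m (k + 1))
    (valueBound_nonneg hb.α_nonneg m) (fun h' hh' => hb.abs_backwardValue_le (by lia) h' hh')
  have h1 := integrable_step π γ hh ((M.measurable_lastCost k).add
      (measurable_backwardValue π γ m (k + 1))) h0
  simp only [Pi.add_apply, lastCost_snoc] at h1 h0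
  exact ⟨fun a ha Q => (h0 a ha Q).1, h1.1, h1.2.2.1, h1.2.2.2⟩

theorem histLaw_self (n : ℕ) : M.histLaw π γ n n le_rfl = Kernel.id := by
  simp [histLaw, Nat.leRec_self]

theorem histLaw_succ {n k : ℕ} (hnk : n ≤ k) : M.histLaw π γ n (k + 1) (by lia) =
    M.stepKernel π γ k ∘ₖ M.histLaw π γ n k hnk := by
  simp [histLaw, Nat.leRec_succ _ _ hnk]

theorem isMarkovKernel_histLaw {n k : ℕ} (hnk : n ≤ k) :
    IsMarkovKernel (M.histLaw π γ n k hnk) := by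
  induction k, hnk using Nat.le_induction with
  | base => rw [histLaw_self]; infer_instance
  | succ k hnk ih => rw [histLaw_succ hnk]; infer_instance

theorem ae_feasible_histLaw {n k : ℕ} (hnk : n ≤ k) {h : Hist A n} (hh : M.Feasible h) :
    ∀ᵐ h' ∂(M.histLaw π γ n k hnk h), M.Feasible h' := by
  induction k, hnk using Nat.le_induction with
  | base =>
    rw [histLaw_self, Kernel.id_apply]
    exact (ae_dirac_iff (M.measurableSet_feasible n)).2 hh
  | succ k hnk ih =>
    rw [histLaw_succ hnk, Kernel.comp_apply]
    refine Measure.ae_comp_of_ae_ae (M.measurableSet_feasible _) ?_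
    filter_upwards [ih] with h' hh'
    exact ae_feasible_step π γ hh'

/-- Each transition multiplies the conditional expectation of `b` by at most `α`. This `b` dominates
the terminal cost and all continuation values. -/
theorem Bounding.integrable_last (hb : M.Bounding α εl εu bl bu) {n k : ℕ} (hnk : n ≤ k)
    (hk : k ≤ M.N) {h : Hist A n} (hh : M.Feasible h) :
    Integrable (fun h' : Hist A k => bu h'.last - bl h'.last) (M.histLaw π γ n k hnk h) := by
  induction k, hnk using Nat.le_induction with
  | base =>
    rw [histLaw_self, Kernel.id_apply]
    exact integrable_dirac' (hb.measurable_b.comp Hist.measurable_last).stronglyMeasurable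
      (by simp)
  | succ k hnk ih =>
    have hbm : ∀ j, Measurable fun h' : Hist A j => bu h'.last - bl h'.last :=
      fun j => hb.measurable_b.comp Hist.measurable_last
    have hnn : ∀ x, 0 ≤ bu x - bl x := fun x => zero_le_one.trans (hb.one_le x)
    have step : ∀ h' : Hist A k, M.Feasible h' → _ := fun h' hh' =>
      integrable_step π γ hh' (hbm (k + 1)) (B := α * (bu h'.last - bl h'.last))
        fun a ha Q => by
          have := hb.bound_bound (by lia) ha Q
          simp only [Hist.last_snoc, abs_of_nonneg (hnn _)]
          exact this
    rw [histLaw_succ hnk, Kernel.comp_apply,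
      Measure.integrable_comp_iff (hbm _).aestronglyMeasurable]
    refine ⟨?_, ?_⟩
    · filter_upwards [ae_feasible_histLaw hnk hh] with h' hh'
      exact (step h' hh').1
    · refine ((ih (by lia)).const_mul α).mono'
        ((hbm _).norm.stronglyMeasurable.integral_kernel
          (κ := M.stepKernel π γ k)).aestronglyMeasurable ?_
      filter_upwards [ae_feasible_histLaw hnk hh] with h' hh'
      rw [Real.norm_of_nonneg (integral_nonneg fun _ => norm_nonneg _)]
      exact (step h' hh').2.1

/-- The cost so far plus the expected cost to go has an expectation that does not depend on `k`, by
the tower property. Taking `k = N` gives the expected total cost, `k = n` the backward recursion. -/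
theorem Bounding.integrable_partialCost (hb : M.Bounding α εl εu bl bu) {n k : ℕ} (hnk : n ≤ k)
    (hk : k ≤ M.N) {h : Hist A n} (hh : M.Feasible h) :
    Integrable (M.partialCost n k) (M.histLaw π γ n k hnk h) ∧
      ∫ h', (M.partialCost n k h' + backwardValue π γ (M.N - k) k h') ∂(M.histLaw π γ n k hnk h) =
        backwardValue π γ (M.N - n) n h := by
  induction k, hnk using Nat.le_induction with
  | base =>
    have : M.partialCost (A := A) n n = fun _ => 0 := funext (partialCost_self n)
    rw [histLaw_self, Kernel.id_apply, this]
    refine ⟨integrable_zero _ _ _, ?_⟩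
    simp only [zero_add]
    exact integral_dirac' _ _ (measurable_backwardValue π γ _ n).stronglyMeasurable
  | succ k hnk ih =>
    obtain ⟨ih1, ih2⟩ := ih (by lia)
    have hpm := M.measurable_partialCost n (k + 1)
    have hV := measurable_backwardValue π γ (M.N - (k + 1)) (k + 1)
    have hmk := isMarkovKernel_histLaw (π := π) (γ := γ) hnk
    have step : ∀ h' : Hist A k, M.Feasible h' → _ := fun h' hh' =>
      integrable_step π γ hh' hpm (B := |M.partialCost n k h'| + (bu h'.last - bl h'.last))
        fun a ha Q => by
          have hc := hb.cost_bound (by lia) ha Q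
          simp only [partialCost_snoc hnk]
          refine ⟨(integrable_const _).add hc.1, ?_⟩
          refine (integral_mono ((integrable_const _).add hc.1).abs
            ((integrable_const |M.partialCost n k h'|).add hc.1.abs)
              fun z => abs_add_le _ _).trans ?_
          have e := integral_add (integrable_const (μ := Q.measure) |M.partialCost n k h'|) hc.1.abs
          simp only [integral_const, probReal_univ, one_smul] at e
          refine (le_of_eq e).trans ?_
          gcongr
          exact hc.2
    have hi1 : Integrable (M.partialCost n (k + 1))
        ((M.stepKernel π γ k).comp (M.histLaw π γ n k hnk) h) := by
      rw [Kernel.comp_apply, Measure.integrable_comp_iff hpm.aestronglyMeasurable]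
      refine ⟨?_, ?_⟩
      · filter_upwards [ae_feasible_histLaw hnk hh] with h' hh'
        exact (step h' hh').1
      · refine (ih1.abs.add (hb.integrable_last hnk (by lia) hh)).mono'
          (hpm.norm.stronglyMeasurable.integral_kernel
            (κ := M.stepKernel π γ k)).aestronglyMeasurable ?_
        filter_upwards [ae_feasible_histLaw hnk hh] with h' hh'
        rw [Real.norm_of_nonneg (integral_nonneg fun _ => norm_nonneg _)]
        exact (step h' hh').2.1
    have hi2 : Integrable (backwardValue π γ (M.N - (k + 1)) (k + 1))
        ((M.stepKernel π γ k).comp (M.histLaw π γ n k hnk) h) := by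
      rw [← histLaw_succ hnk]
      refine ((hb.integrable_last (by lia) hk hh).const_mul (valueBound α (M.N - (k + 1)))).mono'
        hV.aestronglyMeasurable ?_
      filter_upwards [ae_feasible_histLaw (by lia) hh] with h' hh'
      exact hb.abs_backwardValue_le (by lia) h' hh'
    rw [histLaw_succ hnk]
    refine ⟨hi1, ?_⟩
    rw [← ih2]
    refine (Kernel.integral_comp (hi1.add hi2)).trans (integral_congr_ae ?_)
    filter_upwards [ae_feasible_histLaw hnk hh] with h' hh'
    have hNk : M.N - k = (M.N - (k + 1)) + 1 := by lia
    have hs := hb.backwardValue_step (π := π) (γ := γ) (m := M.N - (k + 1)) (by lia) h' hh'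
    rw [hNk, backwardValue]
    have hm := M.measurable_snoc_T h'
    -- The splitting requires `h''` to extend `h'`, which the step kernel guarantees only almost
    -- surely.
    have e : ∀ᵐ h'' ∂(M.stepKernel π γ k h'), M.partialCost n (k + 1) h'' +
        backwardValue π γ (M.N - (k + 1)) (k + 1) h'' = M.partialCost n k h' +
          (M.lastCost k h'' + backwardValue π γ (M.N - (k + 1)) (k + 1) h'') := by
      rw [stepKernel_apply]
      refine (ae_map_iff hm.aemeasurable (measurableSet_eq_fun (hpm.add hV)
        (measurable_const.add ((M.measurable_lastCost k).add hV)))).2 (.of_forall fun w => ?_)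
      simp only [Pi.add_apply]
      rw [partialCost_snoc hnk, lastCost_snoc, add_assoc]
    refine (integral_congr_ae e).trans ?_
    rw [integral_add (integrable_const _) hs.2.1]
    simp

theorem Bounding.integrable_totalCost (hb : M.Bounding α εl εu bl bu) {n : ℕ} (hn : n ≤ M.N)
    {h : Hist A n} (hh : M.Feasible h) :
    Integrable (M.totalCost n) (M.histLaw π γ n M.N hn h) := by
  refine (hb.integrable_partialCost hn le_rfl hh).1.add
    ((hb.integrable_last hn le_rfl hh).mono'
      (M.measurable_cN.comp Hist.measurable_last).aestronglyMeasurable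
      (.of_forall fun h' => hb.abs_cN_le _))

theorem Bounding.policyValue_eq (hb : M.Bounding α εl εu bl bu) {n : ℕ} (hn : n ≤ M.N)
    {h : Hist A n} (hh : M.Feasible h) :
    M.policyValue π γ n hn h = backwardValue π γ (M.N - n) n h := by
  rw [← (hb.integrable_partialCost hn le_rfl hh).2, Nat.sub_self]
  rfl

end Values

end RobustMDP

namespace RobustMDP

variable {A : Type*} {Z : Type*} [MeasurableSpace A] [MeasurableSpace Z] {M : RobustMDP A Z}
  {α εl εu : ℝ} {bl bu : ℝ → ℝ}

/-! ### Value iteration -/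

/-- `m` applications of the Bellman operators to the terminal cost, the last one at stage `k`. -/
noncomputable def iteratedOp (M : RobustMDP A Z) : ℕ → ℕ → ℝ → ℝ
  | 0, _ => M.cN
  | m + 1, k => M.op k (iteratedOp M m (k + 1))

/-- The value of a pair of Markov policies by backward recursion. -/
noncomputable def markovBackwardValue (π : M.MarkovPolicy) (γ : M.MarkovNature) :
    ℕ → ℕ → ℝ → ℝ
  | 0, _ => M.cN
  | m + 1, k => M.opPair k (π.d k) (γ.rule k) (markovBackwardValue π γ m (k + 1))

instance : Nonempty M.MarkovNature :=
  ⟨⟨fun _ _ => Classical.arbitrary _, fun _ => measurable_const⟩⟩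

instance : Nonempty M.NaturePolicy := ⟨(Classical.arbitrary M.MarkovNature).toNature⟩

instance : Nonempty M.MarkovPolicy := by
  choose d hd h using M.exists_graph
  exact ⟨⟨d, hd, h⟩⟩

instance : Nonempty M.RandPolicy := ⟨(Classical.arbitrary M.MarkovPolicy).toRand⟩

theorem feasible_const (π : M.MarkovPolicy) (n : ℕ) (x : ℝ) :
    M.Feasible (A := A) ((fun _ => x, fun k => π.d k x) : Hist A n) := fun k => π.admissible k x

section MarkovPolicies

variable [MeasurableSingletonClass A]

theorem Bounding.backwardValue_toRand_succ (hb : M.Bounding α εl εu bl bu) (π : M.MarkovPolicy)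
    (γ : M.NaturePolicy) {m k : ℕ} (hkm : k + (m + 1) = M.N) {h : Hist A k} (hh : M.Feasible h) :
    backwardValue π.toRand γ (m + 1) k h =
      ∫ z, (M.c k h.last (π.d k h.last) (M.T k h.last (π.d k h.last) z) +
        backwardValue π.toRand γ m (k + 1)
          (h.snoc (π.d k h.last) (M.T k h.last (π.d k h.last) z)))
        ∂(γ.rule k (h, π.d k h.last)).measure := by
  rw [(hb.backwardValue_step hkm h hh).2.2.2, MarkovPolicy.toRand, Kernel.deterministic_apply,
    integral_dirac]

theorem Bounding.backwardValue_markov (hb : M.Bounding α εl εu bl bu) (π : M.MarkovPolicy)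
    (γ : M.MarkovNature) {m k : ℕ} (hkm : k + m = M.N) {h : Hist A k} (hh : M.Feasible h) :
    backwardValue π.toRand γ.toNature m k h = markovBackwardValue π γ m k h.last := by
  induction m generalizing k with
  | zero => rfl
  | succ m ih =>
    rw [hb.backwardValue_toRand_succ π _ hkm hh, markovBackwardValue, opPair, L]
    refine integral_congr_ae (.of_forall fun z => ?_)
    simp only
    rw [ih (by lia) (feasible_snoc.2 ⟨hh, π.admissible k _⟩), Hist.last_snoc]

theorem Bounding.policyValue_markov (hb : M.Bounding α εl εu bl bu) (π : M.MarkovPolicy)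
    (γ : M.MarkovNature) {n : ℕ} (hn : n ≤ M.N) {h : Hist A n} (hh : M.Feasible h) :
    M.policyValue π.toRand γ.toNature n hn h = markovBackwardValue π γ (M.N - n) n h.last := by
  rw [hb.policyValue_eq hn hh, hb.backwardValue_markov π γ (by lia) hh]

theorem Bounding.markovValue_eq (hb : M.Bounding α εl εu bl bu) (π : M.MarkovPolicy)
    (γ : M.MarkovNature) {n : ℕ} (hn : n ≤ M.N) (x : ℝ) :
    M.markovValue π γ n hn x = markovBackwardValue π γ (M.N - n) n x :=
  hb.policyValue_markov π γ hn (feasible_const π n x)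

/-- Minimizers are good against every policy of nature. -/
theorem Bounding.backwardValue_le_iteratedOp (hb : M.Bounding α εl εu bl bu)
    (hv : ∀ m k, k + m = M.N → M.iteratedOp m k ∈ potentialValueFunctions fun x => bu x - bl x)
    {π : M.MarkovPolicy} (hπ : ∀ m k, k + (m + 1) = M.N → ∀ x,
      M.opRule k (π.d k) (M.iteratedOp m (k + 1)) x = M.op k (M.iteratedOp m (k + 1)) x)
    (γ : M.NaturePolicy) {m k : ℕ} (hkm : k + m = M.N) {h : Hist A k} (hh : M.Feasible h) :
    backwardValue π.toRand γ m k h ≤ M.iteratedOp m k h.last := by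
  induction m generalizing k with
  | zero => exact le_rfl
  | succ m ih =>
    obtain ⟨hvm, ⟨lam, hlam, hle⟩, -, -⟩ := hv m (k + 1) (by lia)
    have ha := π.admissible k h.last
    rw [hb.backwardValue_toRand_succ π _ hkm hh, iteratedOp, ← hπ m k hkm]
    -- Nature's measure depends on the whole history, yet it is still one competitor in the
    -- supremum.
    refine le_trans ?_ (le_ciSup (hb.bddAbove_L (by lia) ha hvm hlam hle)
      (γ.rule k (h, π.d k h.last)))
    refine integral_mono ((hb.backwardValue_step hkm h hh).1 _ ha _)
      (hb.integrable_integrand (by lia) ha _ hvm hle) fun z => ?_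
    have := ih (k := k + 1) (by lia)
      (h := h.snoc (π.d k h.last) (M.T k h.last (π.d k h.last) z)) (feasible_snoc.2 ⟨hh, ha⟩)
    rw [Hist.last_snoc] at this
    exact add_le_add_right this _

end MarkovPolicies

/-- Almost maximizers are good against every policy of the controller. -/
theorem Bounding.iteratedOp_le_backwardValue (hb : M.Bounding α εl εu bl bu)
    (hv : ∀ m k, k + m = M.N → M.iteratedOp m k ∈ potentialValueFunctions fun x => bu x - bl x)
    (hop : ∀ m k, k + (m + 1) = M.N → ∀ x a, (x, a) ∈ M.D k →
      M.op k (M.iteratedOp m (k + 1)) x ≤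
        ⨆ Q : M.Amb (k + 1), M.L k (M.iteratedOp m (k + 1)) x a Q)
    {γ : M.MarkovNature} {ε : ℝ} (hγ : ∀ m k, k + (m + 1) = M.N → ∀ x a, (x, a) ∈ M.D k →
      ⨆ Q : M.Amb (k + 1), M.L k (M.iteratedOp m (k + 1)) x a Q ≤
        M.L k (M.iteratedOp m (k + 1)) x a (γ.rule k (x, a)) + ε)
    (π : M.RandPolicy) {m k : ℕ} (hkm : k + m = M.N) {h : Hist A k} (hh : M.Feasible h) :
    M.iteratedOp m k h.last - m * ε ≤ backwardValue π γ.toNature m k h := by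
  induction m generalizing k with
  | zero => simp [iteratedOp, backwardValue]
  | succ m ih =>
    obtain ⟨hvm, ⟨lam, hlam, hle⟩, -, -⟩ := hv m (k + 1) (by lia)
    obtain ⟨h1, -, h3, h4⟩ := hb.backwardValue_step (π := π) (γ := γ.toNature) hkm h hh
    rw [h4]
    -- The bound holds for almost every action drawn, so randomization cannot beat it. Later stages
    -- lose `m * ε`, the present one a further `ε`.
    have key : ∀ᵐ a ∂(π.kernel k h), M.iteratedOp (m + 1) k h.last - ((m + 1 : ℕ) : ℝ) * ε ≤
        ∫ z, (M.c k h.last a (M.T k h.last a z) + backwardValue π γ.toNature m (k + 1)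
          (h.snoc a (M.T k h.last a z))) ∂(γ.toNature.rule k (h, a)).measure := by
      filter_upwards [ae_mem_D π hh] with a ha
      have hLi := hb.integrable_integrand (by lia) ha (γ.toNature.rule k (h, a)) hvm hle
      have e1 : M.L k (M.iteratedOp m (k + 1)) h.last a (γ.rule k (h.last, a)) - m * ε ≤
          ∫ z, (M.c k h.last a (M.T k h.last a z) + backwardValue π γ.toNature m (k + 1)
            (h.snoc a (M.T k h.last a z))) ∂(γ.toNature.rule k (h, a)).measure := by
        have : M.L k (M.iteratedOp m (k + 1)) h.last a (γ.rule k (h.last, a)) - m * ε =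
            ∫ z, ((M.c k h.last a (M.T k h.last a z) +
              M.iteratedOp m (k + 1) (M.T k h.last a z)) - m * ε)
                ∂(γ.toNature.rule k (h, a)).measure := by
          rw [integral_sub hLi (integrable_const _)]
          simp [L, MarkovNature.toNature]
        rw [this]
        refine integral_mono (hLi.sub (integrable_const _)) (h1 a ha _) fun z => ?_
        have := ih (k := k + 1) (by lia) (h := h.snoc a (M.T k h.last a z))
          (feasible_snoc.2 ⟨hh, ha⟩)
        rw [Hist.last_snoc] at this
        simp only
        linarith
      have e2 := hop m k hkm h.last a ha
      have e3 := hγ m k hkm h.last a ha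
      rw [iteratedOp]
      push_cast
      linarith
    have := integral_mono_ae (integrable_const _) h3 key
    simpa using this

end RobustMDP

/-! ### Identification of the value functions and optimal policies -/

namespace RobustMDP

variable {A : Type*} {Z : Type*} [MeasurableSpace A] [MeasurableSpace Z] {M : RobustMDP A Z}
  {α εl εu : ℝ} {bl bu : ℝ → ℝ}

theorem Bounding.exists_abs_policyValue_le (hb : M.Bounding α εl εu bl bu) :
    ∃ C : ℝ, ∀ (π : M.RandPolicy) (γ : M.NaturePolicy) (n : ℕ) (hn : n ≤ M.N) (h : Hist A n),
      M.Feasible h → |M.policyValue π γ n hn h| ≤ C * (bu h.last - bl h.last) := by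
  -- The sum dominates the constant of every number of remaining stages at once.
  refine ⟨∑ m ∈ Finset.range (M.N + 1), valueBound α m, fun π γ n hn h hh => ?_⟩
  rw [hb.policyValue_eq hn hh]
  refine (hb.abs_backwardValue_le (by lia) h hh).trans ?_
  refine mul_le_mul_of_nonneg_right ?_ (zero_le_one.trans (hb.one_le _))
  exact Finset.single_le_sum (f := valueBound α) (fun m _ => valueBound_nonneg hb.α_nonneg m)
    (Finset.mem_range.2 (by lia))

/-- Identification of both value functions from below by almost optimal policies of nature and
from above by one optimal Markov policy of the controller. -/
theorem Bounding.values_eq [MeasurableSingletonClass A] (hb : M.Bounding α εl εu bl bu)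
    {π₀ : M.MarkovPolicy} {n : ℕ} (hn : n ≤ M.N) {v : ℝ → ℝ}
    (hlow : ∀ (π : M.RandPolicy) (h : Hist A n), M.Feasible h → ∀ ε > 0, ∃ γ : M.MarkovNature,
      v h.last - ε ≤ M.policyValue π γ.toNature n hn h)
    (hup : ∀ (γ : M.NaturePolicy) (h : Hist A n), M.Feasible h →
      M.policyValue π₀.toRand γ n hn h ≤ v h.last) :
    (∀ h : Hist A n, M.Feasible h → M.robustPolicyValue π₀.toRand n hn h = v h.last) ∧
    (∀ h : Hist A n, M.Feasible h → M.valueFun n hn h = v h.last) ∧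
    (∀ x, M.robustMarkovValue π₀ n hn x = v x) ∧ ∀ x, M.J n hn x = v x := by
  obtain ⟨C, hC⟩ := hb.exists_abs_policyValue_le
  have hbd : ∀ (π : M.RandPolicy) (h : Hist A n), M.Feasible h →
      BddAbove (Set.range fun γ : M.NaturePolicy => M.policyValue π γ n hn h) := by
    rintro π h hh
    refine ⟨C * (bu h.last - bl h.last), ?_⟩
    rintro _ ⟨γ, rfl⟩
    exact (abs_le.1 (hC π γ n hn h hh)).2
  have hbdM : ∀ (π : M.MarkovPolicy) (x : ℝ),
      BddAbove (Set.range fun γ : M.MarkovNature => M.markovValue π γ n hn x) := by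
    refine fun π x => (hbd π.toRand _ (feasible_const π n x)).mono ?_
    rintro _ ⟨γ, rfl⟩
    exact ⟨γ.toNature, rfl⟩
  have hge : ∀ (π : M.RandPolicy) (h : Hist A n), M.Feasible h →
      v h.last ≤ M.robustPolicyValue π n hn h := by
    intro π h hh
    refine le_of_forall_sub_le fun ε hε => ?_
    obtain ⟨γ, hγ⟩ := hlow π h hh ε hε
    exact hγ.trans (le_ciSup (hbd π h hh) γ.toNature)
  have hgeM : ∀ (π : M.MarkovPolicy) (x : ℝ), v x ≤ M.robustMarkovValue π n hn x := by
    intro π x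
    refine le_of_forall_sub_le fun ε hε => ?_
    obtain ⟨γ, hγ⟩ := hlow π.toRand _ (feasible_const π n x) ε hε
    exact hγ.trans (le_ciSup (hbdM π x) γ)
  have h1 : ∀ h : Hist A n, M.Feasible h → M.robustPolicyValue π₀.toRand n hn h = v h.last :=
    fun h hh => le_antisymm (ciSup_le fun γ => hup γ h hh) (hge _ h hh)
  have h2 : ∀ x, M.robustMarkovValue π₀ n hn x = v x := fun x =>
    le_antisymm (ciSup_le fun γ => hup γ.toNature _ (feasible_const π₀ n x)) (hgeM _ x)
  refine ⟨h1, fun h hh => le_antisymm ?_ (le_ciInf fun π => hge π h hh), h2,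
    fun x => le_antisymm ?_ (le_ciInf fun π => hgeM π x)⟩
  · rw [← h1 h hh]
    refine ciInf_le ⟨v h.last, ?_⟩ π₀.toRand
    rintro _ ⟨π, rfl⟩
    exact hge π h hh
  · rw [← h2 x]
    refine ciInf_le ⟨v x, ?_⟩ π₀
    rintro _ ⟨π, rfl⟩
    exact hgeM π x

section Assumptions

variable [TopologicalSpace A] [TopologicalSpace.MetrizableSpace A] [SecondCountableTopology A]
  [BorelSpace A] (hb : M.Bounding α εl εu bl bu) (hdom : M.LocallyDominated bl bu)
  (hsemi : M.Semicontinuous) (hmono : M.MonotoneData)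
include hb hdom hsemi hmono

theorem iteratedOp_mem {m k : ℕ} (hkm : k + m = M.N) :
    M.iteratedOp m k ∈ potentialValueFunctions fun x => bu x - bl x := by
  induction m generalizing k with
  | zero =>
    exact ⟨M.measurable_cN, ⟨1, zero_le_one, fun x => by
      rw [one_mul]; exact hb.abs_cN_le x⟩, hsemi.lsc_cN, hmono.monotone_cN⟩
  | succ m ih => exact op_mem_potentialValueFunctions hb hdom hsemi hmono (by lia) (ih (by lia))

theorem exists_minimizing_iteratedOp : ∃ π : M.MarkovPolicy, ∀ m k, k + (m + 1) = M.N → ∀ x,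
    M.opRule k (π.d k) (M.iteratedOp m (k + 1)) x = M.op k (M.iteratedOp m (k + 1)) x := by
  have : ∀ k, ∃ d : ℝ → A, Measurable d ∧ (∀ x, (x, d x) ∈ M.D k) ∧ ∀ m, k + (m + 1) = M.N →
      ∀ x, M.opRule k d (M.iteratedOp m (k + 1)) x = M.op k (M.iteratedOp m (k + 1)) x := by
    intro k
    rcases lt_or_ge k M.N with hk | hk
    · obtain ⟨d, hd, hD, hop, -⟩ := exists_minimizer hb hdom hsemi hmono hk
        (iteratedOp_mem hb hdom hsemi hmono (m := M.N - (k + 1)) (k := k + 1) (by lia))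
      refine ⟨d, hd, hD, fun m hm => ?_⟩
      obtain rfl : m = M.N - (k + 1) := by lia
      exact hop
    · obtain ⟨d, hd, hD⟩ := M.exists_graph k
      exact ⟨d, hd, hD, fun m hm => by lia⟩
  choose d hd hD hop using this
  exact ⟨⟨d, hd, hD⟩, fun m k => hop k m⟩

theorem exists_almost_maximizing_iteratedOp {ε : ℝ} (hε : 0 < ε) :
    ∃ γ : M.MarkovNature, ∀ m k, k + (m + 1) = M.N → ∀ x a, (x, a) ∈ M.D k →
      ⨆ Q : M.Amb (k + 1), M.L k (M.iteratedOp m (k + 1)) x a Q ≤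
        M.L k (M.iteratedOp m (k + 1)) x a (γ.rule k (x, a)) + ε := by
  have : ∀ k, ∃ g : ℝ × A → M.Amb (k + 1), Measurable g ∧ ∀ m, k + (m + 1) = M.N →
      ∀ x a, (x, a) ∈ M.D k → ⨆ Q : M.Amb (k + 1), M.L k (M.iteratedOp m (k + 1)) x a Q ≤
        M.L k (M.iteratedOp m (k + 1)) x a (g (x, a)) + ε := by
    intro k
    rcases lt_or_ge k M.N with hk | hk
    · obtain ⟨g, hg, h⟩ := exists_almost_maximizer hb hdom hk
        (iteratedOp_mem hb hdom hsemi hmono (m := M.N - (k + 1)) (k := k + 1) (by lia)) hε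
      refine ⟨g, hg, fun m hm => ?_⟩
      obtain rfl : m = M.N - (k + 1) := by lia
      exact h
    · exact ⟨fun _ => Classical.arbitrary _, measurable_const, fun m hm => by lia⟩
  choose g hg h using this
  exact ⟨⟨g, hg⟩, fun m k => h k m⟩

/-- Minimizers of the Bellman operators are optimal, and value iteration yields the values. -/
theorem values_eq_iteratedOp {π₀ : M.MarkovPolicy} (hπ₀ : ∀ m k, k + (m + 1) = M.N → ∀ x,
      M.opRule k (π₀.d k) (M.iteratedOp m (k + 1)) x = M.op k (M.iteratedOp m (k + 1)) x)
    {n : ℕ} (hn : n ≤ M.N) :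
    (∀ h : Hist A n, M.Feasible h →
      M.robustPolicyValue π₀.toRand n hn h = M.iteratedOp (M.N - n) n h.last) ∧
    (∀ h : Hist A n, M.Feasible h → M.valueFun n hn h = M.iteratedOp (M.N - n) n h.last) ∧
    (∀ x, M.robustMarkovValue π₀ n hn x = M.iteratedOp (M.N - n) n x) ∧
    ∀ x, M.J n hn x = M.iteratedOp (M.N - n) n x := by
  have hv : ∀ m k, k + m = M.N →
      M.iteratedOp m k ∈ potentialValueFunctions fun x => bu x - bl x :=
    fun m k hkm => iteratedOp_mem hb hdom hsemi hmono hkm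
  refine hb.values_eq hn (fun π h hh ε hε => ?_) fun γ h hh => ?_
  -- At most `N` stages remain, so a loss of `ε / (N + 1)` per stage adds up to at most `ε`; the `+
  -- 1` covers `N = 0`.
  · obtain ⟨γ, hγ⟩ := exists_almost_maximizing_iteratedOp hb hdom hsemi hmono
      (show 0 < ε / (M.N + 1) by positivity)
    refine ⟨γ, ?_⟩
    rw [hb.policyValue_eq hn hh]
    refine le_trans ?_ (hb.iteratedOp_le_backwardValue hv (fun m k hkm x a ha => ?_) hγ π
      (m := M.N - n) (k := n) (by lia) hh)
    · have h1 : ((M.N - n : ℕ) : ℝ) ≤ M.N + 1 := by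
        have : ((M.N - n : ℕ) : ℝ) ≤ M.N := by exact_mod_cast Nat.sub_le _ _
        linarith
      have h2 : ((M.N - n : ℕ) : ℝ) * (ε / (M.N + 1)) ≤ (M.N + 1) * (ε / (M.N + 1)) := by gcongr
      rw [mul_div_cancel₀ _ (by positivity)] at h2
      linarith
    · obtain ⟨d, -, -, -, h⟩ := exists_minimizer hb hdom hsemi hmono (n := k) (by lia)
        (hv m (k + 1) (by lia))
      exact h x a ha
  · rw [hb.policyValue_eq hn hh]
    exact hb.backwardValue_le_iteratedOp hv hπ₀ γ (by lia) hh

theorem J_eq_iteratedOp {n : ℕ} (hn : n ≤ M.N) : M.J n hn = M.iteratedOp (M.N - n) n := by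
  obtain ⟨π₀, hπ₀⟩ := exists_minimizing_iteratedOp hb hdom hsemi hmono
  exact funext (values_eq_iteratedOp hb hdom hsemi hmono hπ₀ hn).2.2.2

theorem J_succ_eq_iteratedOp {m k : ℕ} (hkm : k + (m + 1) = M.N) :
    M.J (k + 1) (by lia) = M.iteratedOp m (k + 1) := by
  rw [J_eq_iteratedOp hb hdom hsemi hmono (by lia)]
  congr 1
  lia

/-- With `J` identified, minimality with respect to `J` can be traded for minimality with respect to
value iteration, for which the bounds were proved. -/
theorem isMinimizing_iff {π : M.MarkovPolicy} :
    M.IsMinimizing π ↔ ∀ m k, k + (m + 1) = M.N → ∀ x,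
      M.opRule k (π.d k) (M.iteratedOp m (k + 1)) x = M.op k (M.iteratedOp m (k + 1)) x := by
  constructor
  · intro h m k hkm x
    rw [← J_succ_eq_iteratedOp hb hdom hsemi hmono hkm]
    exact h k (by lia) x
  · intro h k hk x
    rw [J_succ_eq_iteratedOp hb hdom hsemi hmono (m := M.N - (k + 1)) (by lia)]
    exact h _ k (by lia) x

theorem J_eq_op {n : ℕ} (hn : n < M.N) : M.J n hn.le = M.op n (M.J (n + 1) hn) := by
  rw [J_eq_iteratedOp hb hdom hsemi hmono hn.le, J_eq_iteratedOp hb hdom hsemi hmono hn,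
    show M.N - n = (M.N - (n + 1)) + 1 by lia]
  rfl

theorem J_mem {n : ℕ} (hn : n ≤ M.N) :
    M.J n hn ∈ potentialValueFunctions fun x => bu x - bl x := by
  rw [J_eq_iteratedOp hb hdom hsemi hmono hn]
  exact iteratedOp_mem hb hdom hsemi hmono (by lia)

/-- A maximizer at every admissible pair attains in particular the supremum along `π`, which equals
`J` by minimality and the Bellman equation. -/
theorem exists_isMaximizing (hcl : M.WeakStarClosed) {π : M.MarkovPolicy}
    (hπ : M.IsMinimizing π) : ∃ γ : M.MarkovNature, M.IsMaximizing π γ ∧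
      ∀ (n : ℕ) (hn : n < M.N) (x : ℝ) (a : A), (x, a) ∈ M.D n → ∀ Q : M.Amb (n + 1),
        M.L n (M.J (n + 1) hn) x a Q ≤ M.L n (M.J (n + 1) hn) x a (γ.rule n (x, a)) := by
  have : ∀ n, ∃ g : ℝ × A → M.Amb (n + 1), Measurable g ∧ ∀ (hn : n < M.N) (x : ℝ) (a : A),
      (x, a) ∈ M.D n → ∀ Q : M.Amb (n + 1),
        M.L n (M.J (n + 1) hn) x a Q ≤ M.L n (M.J (n + 1) hn) x a (g (x, a)) := by
    intro n
    by_cases hn : n < M.N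
    · obtain ⟨g, hg, h⟩ := exists_maximizer hb hdom hcl hn (J_mem hb hdom hsemi hmono hn)
      exact ⟨g, hg, fun _ => h⟩
    · exact ⟨fun _ => Classical.arbitrary _, measurable_const, fun h => absurd h hn⟩
  choose g hg h using this
  refine ⟨⟨g, hg⟩, fun n hn x => ?_, h⟩
  have ha := π.admissible n x
  obtain ⟨hvm, ⟨lam, hlam, hle⟩, -, -⟩ := J_mem hb hdom hsemi hmono hn
  rw [J_eq_op hb hdom hsemi hmono hn, ← hπ n hn x]
  exact le_antisymm (ciSup_le fun Q => h n hn x _ ha Q)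
    (le_ciSup (hb.bddAbove_L hn ha hvm hlam hle) _)

/-- Both sides satisfy the same backward recursion with terminal value `M.cN`. -/
theorem IsMaximizing.markovValue_eq {π : M.MarkovPolicy} {γ : M.MarkovNature}
    (hγ : M.IsMaximizing π γ) {n : ℕ} (hn : n ≤ M.N) (x : ℝ) :
    M.J n hn x = M.markovValue π γ n hn x := by
  have key : ∀ m k (hkm : k + m = M.N), M.J k (by lia) = markovBackwardValue π γ m k := by
    intro m
    induction m with
    | zero =>
      intro k hkm
      rw [J_eq_iteratedOp hb hdom hsemi hmono, show M.N - k = 0 by lia]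
      rfl
    | succ m ih =>
      intro k hkm
      funext x
      rw [hγ k (by lia) x, ih (k + 1) (by lia)]
      rfl
  rw [hb.markovValue_eq, key (M.N - n) n (by lia)]

end Assumptions

end RobustMDP

/-! ### The main theorem -/

theorem mainTheorem7 {A : Type*} {Z : Type*}
    [TopologicalSpace A] [TopologicalSpace.MetrizableSpace A] [SecondCountableTopology A]
    [MeasurableSpace A] [BorelSpace A] [StandardBorelSpace A]
    [MeasurableSpace Z] (M : RobustMDP A Z)
    (α εl εu : ℝ) (bl bu : ℝ → ℝ)
    (hbound : M.Bounding α εl εu bl bu)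
    (hdom : M.LocallyDominated bl bu)
    (hsemi : M.Semicontinuous)
    (hmono : M.MonotoneData) :
    -- all expectations, suprema and infima below are those of integrable / bounded quantities
    (∃ C : ℝ, ∀ (π : M.RandPolicy) (γ : M.NaturePolicy) (n : ℕ) (hn : n ≤ M.N) (h : Hist A n),
      M.Feasible h →
        Integrable (M.totalCost n) (M.histLaw π γ n M.N hn h) ∧
        |M.policyValue π γ n hn h| ≤ C * (bu h.last - bl h.last)) ∧
    (∀ n < M.N, ∀ v ∈ potentialValueFunctions (fun x => bu x - bl x),
      ∃ C : ℝ, ∀ x a, (x, a) ∈ M.D n → ∀ Q : M.Amb (n + 1),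
        Integrable (fun z => M.c n x a (M.T n x a z) + v (M.T n x a z)) Q.measure ∧
        |M.L n v x a Q| ≤ C * (bu x - bl x)) ∧
    -- the value of Markov policies depends on the history only through the current state
    (∀ (π : M.MarkovPolicy) (γ : M.MarkovNature) (n : ℕ) (hn : n ≤ M.N) (h : Hist A n),
      M.Feasible h →
        M.policyValue π.toRand γ.toNature n hn h = M.markovValue π γ n hn h.last) ∧
    -- Markov policies suffice
    (∀ (n : ℕ) (hn : n ≤ M.N) (h : Hist A n), M.Feasible h →
      M.valueFun n hn h = M.J n hn h.last) ∧
    -- the value functions are in `𝔹`; in particular they are increasing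
    (∀ (n : ℕ) (hn : n ≤ M.N), M.J n hn ∈ potentialValueFunctions (fun x => bu x - bl x)) ∧
    (∀ n < M.N, ∀ v ∈ potentialValueFunctions (fun x => bu x - bl x),
      M.op n v ∈ potentialValueFunctions (fun x => bu x - bl x)) ∧
    -- Bellman equation
    (∀ x, M.J M.N le_rfl x = M.cN x) ∧
    (∀ (n : ℕ) (hn : n < M.N) (x : ℝ), M.J n hn.le x = M.op n (M.J (n + 1) hn) x) ∧
    -- minimizers exist, and every sequence of minimizers is an optimal policy
    (∃ π : M.MarkovPolicy, M.IsMinimizing π) ∧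
    (∀ π : M.MarkovPolicy, M.IsMinimizing π → ∀ (n : ℕ) (hn : n ≤ M.N),
      (∀ x, M.robustMarkovValue π n hn x = M.J n hn x) ∧
      (∀ h : Hist A n, M.Feasible h →
        M.robustPolicyValue π.toRand n hn h = M.valueFun n hn h)) ∧
    -- optimal policies of nature
    (M.WeakStarClosed → ∀ π : M.MarkovPolicy, M.IsMinimizing π →
      (∃ γ : M.MarkovNature, M.IsMaximizing π γ ∧
        ∀ (n : ℕ) (hn : n < M.N) (x : ℝ) (a : A), (x, a) ∈ M.D n → ∀ Q : M.Amb (n + 1),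
          M.L n (M.J (n + 1) hn) x a Q ≤ M.L n (M.J (n + 1) hn) x a (γ.rule n (x, a))) ∧
      (∀ γ : M.MarkovNature, M.IsMaximizing π γ → ∀ (n : ℕ) (hn : n ≤ M.N) (x : ℝ),
        M.J n hn x = M.markovValue π γ n hn x)) := by
  obtain ⟨C, hC⟩ := hbound.exists_abs_policyValue_le
  refine ⟨⟨C, fun π γ n hn h hh => ⟨hbound.integrable_totalCost hn hh, hC π γ n hn h hh⟩⟩,
    ?_, ?_, ?_, ?_, ?_, ?_, ?_, ?_, ?_, ?_⟩
  · rintro n hn v ⟨hvm, ⟨lam, hlam, hle⟩, -, -⟩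
    exact ⟨1 + lam * α, fun x a hxa Q => ⟨hbound.integrable_integrand hn hxa Q hvm hle,
      hbound.abs_L_le hn hxa Q hvm hlam hle⟩⟩
  · intro π γ n hn h hh
    rw [hbound.policyValue_markov π γ hn hh, hbound.markovValue_eq]
  · intro n hn h hh
    obtain ⟨π₀, hπ₀⟩ := RobustMDP.exists_minimizing_iteratedOp hbound hdom hsemi hmono
    obtain ⟨-, h1, -, h2⟩ := RobustMDP.values_eq_iteratedOp hbound hdom hsemi hmono hπ₀ hn
    rw [h1 h hh, h2]
  · exact fun n hn => RobustMDP.J_mem hbound hdom hsemi hmono hn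
  · exact fun n hn v hv => RobustMDP.op_mem_potentialValueFunctions hbound hdom hsemi hmono hn hv
  · intro x
    rw [RobustMDP.J_eq_iteratedOp hbound hdom hsemi hmono, Nat.sub_self]
    rfl
  · exact fun n hn x => congrFun (RobustMDP.J_eq_op hbound hdom hsemi hmono hn) x
  · obtain ⟨π₀, hπ₀⟩ := RobustMDP.exists_minimizing_iteratedOp hbound hdom hsemi hmono
    exact ⟨π₀, (RobustMDP.isMinimizing_iff hbound hdom hsemi hmono).2 hπ₀⟩
  · intro π hπ n hn
    have hπ' := (RobustMDP.isMinimizing_iff hbound hdom hsemi hmono).1 hπ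
    obtain ⟨h1, h2, h3, h4⟩ := RobustMDP.values_eq_iteratedOp hbound hdom hsemi hmono hπ' hn
    exact ⟨fun x => (h3 x).trans (h4 x).symm, fun h hh => (h1 h hh).trans (h2 h hh).symm⟩
  · exact fun hcl π hπ => ⟨RobustMDP.exists_isMaximizing hbound hdom hsemi hmono hcl hπ,
      fun γ hγ n hn x => RobustMDP.IsMaximizing.markovValue_eq hbound hdom hsemi hmono hγ hn x⟩
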